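/- \textbf{Setting.} Let $d,k,T\ge 1$ be integers and $X\subset\mathbb Z^d\times\{0,\dots,T-1\}^k$ a nonempty set which is $T$-periodic in $e_1,\dots,e_d$. Write $i=(i^d,i^k)$ for its points. Let $\mathcal E\subset X\times X$ be a set of edges which is $T$-periodic in $e_1,\dots,e_d$, has finite range ($|i-j|\le R$ for all $(i,j)\in\mathcal E$, for some $R>0$), and makes $X$ a connected graph. Let $a_{ij}$ $(i,j\in X)$ be coefficients that are $T$-periodic, $a_{i+Te_m\,j+Te_m}=a_{ij}$ for $m=1,\dots,d$, with $a_{ij}>0$ if $(i,j)\in\mathcal E$ and $a_{ij}=0$ otherwise. For $u_\varepsilon:\varepsilon X\to\mathbb R$ write $u_i^\varepsilon=u_\varepsilon(\varepsilon i)$ and $$F_\varepsilon(u_\varepsilon)=\sum_{i,j\in X}\varepsilon^d a_{ij}\Bigl(\frac{u^\varepsilon_i-u^\varepsilon_j}{\varepsilon}\Bigr)^2 ,$$ and, for $\Omega\subset\mathbb R^d$, let $F_\varepsilon(u_\varepsilon;\Omega)$ be the same sum restricted to those $i,j\in X$ with $\varepsilon i^d,\varepsilon j^d\in\Omega$. Put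 $Q_{T,n}=[0,T)^n$, $Q_n=[0,1)^n$, $Q^l_{T,d}=lT+Q_{T,d}$ for $l\in\mathbb Z^d$, and $Q_n^m=m+Q_n$ for $m\in\mathbb Z^n$. Let $\Omega\subset\mathbb R^d$ be an open set with Lipschitz boundary, and $$\mathcal L_\varepsilon=\{l\in\mathbb Z^d:\ \varepsilon Tl\in\Omega,\ \operatorname{dist}(\varepsilon Tl,\partial\Omega)>2\varepsilon\sqrt d\,T\},\qquad \widetilde\Omega_\varepsilon=\bigcup_{l\in\mathcal L_\varepsilon}\varepsilon Q^l_{T,d}\times Q_{T,k}$$ (with $\operatorname{dist}(\cdot,\emptyset)=\infty$). Let $\tilde u^l_\varepsilon$ be the average of $u^\varepsilon_i$ over $i\in(Q^l_{T,d}\times Q_{T,k})\cap X$, and let $\overline u_\varepsilon=\sum_{l:\,\varepsilon Q^l_{T,d}\subset\Omega}\tilde u^l_\varepsilon\chi_{\varepsilon Q^l_{T,d}}$. Identify $u_\varepsilon$ with its piecewise-constant interpolation, equal to $u^\varepsilon_i$ on $\varepsilon Q_d^{i^d}\times Q_k^{i^k}$ for $i\in X$. \textbf{Proposition.} (a) Let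 $\varepsilon\to0^+$ along a sequence and let $u_\varepsilon:\varepsilon X\to\mathbb R$ satisfy $$\sup_\varepsilon\Bigl(\sum_{l\in\mathcal L_\varepsilon}\ \sum_{i\in(Q^l_{T,d}\times Q_{T,k})\cap X}\varepsilon^d|u^\varepsilon_i|^2+F_\varepsilon(u_\varepsilon)\Bigr)<\infty .$$ Then there are a subsequence (not relabelled) and $u\in H^1(\Omega)$ such that $\overline u_\varepsilon\to u$ strongly in $L^2_{\rm loc}(\Omega)$ and, if $\Omega$ is bounded, $$\int_{\widetilde\Omega_\varepsilon}|u_\varepsilon(x^d,x^k)-u(x^d)|^2\,\chi_{\bigcup_{i\in X}\varepsilon Q_d^{i^d}\times Q_k^{i^k}}(x^d,x^k)\,dx^d\,dx^k\ \to\ 0 .$$ If $\Omega$ is not bounded, the same holds with $\widetilde\Omega_\varepsilon$ replaced by $\widetilde\Omega_\varepsilon\cap(B\times\mathbb R^k)$, for every bounded set $B\subset\mathbb R^d$ (with the same subsequence for all $B$). (b) The same holds with the localized energy $F_\varepsilon(u_\varepsilon;\Omega)$ in the place of $F_\varepsilon(u_\varepsilon)$, up to taking a larger period: there is $T_0$,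 depending only on $d,k,T,X,\mathcal E$ and the coefficients $a_{ij}$, such that, for every multiple $T'\ge T_0$ of $T$ with $T'\ge1$, the statement holds for every $\Omega$ and every such sequence when $T'$ replaces $T$ in the definitions of $\mathcal L_\varepsilon$, $\widetilde\Omega_\varepsilon$, $\tilde u_\varepsilon^l$ and $\overline u_\varepsilon$ and in the bound. -/

import Mathlib

open Set Filter Topology MeasureTheory
open scoped NNReal ENNReal ContDiff

noncomputable section

/-- The space `ℝⁿ` with its Euclidean norm. -/
abbrev Space (n : ℕ) : Type := EuclideanSpace ℝ (Fin n)

/-- Lattice points `i = (i^d, i^k)` of `ℤ^d × ℤ^k`. -/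
abbrev Node (d k : ℕ) : Type := (Fin d → ℤ) × (Fin k → ℤ)

/-- The translate `i + t e_m` of a node in the direction `e_m`, `m = 1, …, d`. -/
def shift {d k : ℕ} (t : ℕ) (m : Fin d) (i : Node d k) : Node d k :=
  (i.1 + Pi.single m (t : ℤ), i.2)

/-- The standing assumptions on the node set `X ⊆ ℤ^d × {0, …, T-1}^k`, on the set of
edges `E ⊆ X × X` and on the coefficients `a`. An edge may be run through in both directions
when two nodes are joined by a path. -/
structure IsThinNetwork {d k : ℕ} (T : ℕ) (X : Set (Node d k)) (E : Set (Node d k × Node d k))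
    (a : Node d k → Node d k → ℝ) : Prop where
  nonempty : X.Nonempty
  bounded : ∀ i ∈ X, ∀ n, 0 ≤ i.2 n ∧ i.2 n < (T : ℤ)
  periodic : ∀ i m, shift T m i ∈ X ↔ i ∈ X
  edges_subset : ∀ i j, (i, j) ∈ E → i ∈ X ∧ j ∈ X
  edges_periodic : ∀ i j, (i, j) ∈ E → ∀ m, (shift T m i, shift T m j) ∈ E
  connected : ∀ i ∈ X, ∀ j ∈ X,
    Relation.ReflTransGen (fun p q : Node d k => (p, q) ∈ E ∨ (q, p) ∈ E) i j
  finite_range : ∃ R : ℝ, 0 < R ∧ ∀ i j, (i, j) ∈ E →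
    Real.sqrt ((∑ m, ((i.1 m : ℝ) - j.1 m) ^ 2) + ∑ n, ((i.2 n : ℝ) - j.2 n) ^ 2) ≤ R
  coeff_periodic : ∀ i ∈ X, ∀ j ∈ X, ∀ m, a (shift T m i) (shift T m j) = a i j
  coeff_pos : ∀ i ∈ X, ∀ j ∈ X, (i, j) ∈ E → 0 < a i j
  coeff_zero : ∀ i ∈ X, ∀ j ∈ X, (i, j) ∉ E → a i j = 0

/-- The semi-open cube `s (l + [0,1)ⁿ)`. Thus `ε Q^l_{T,d} = cube (ε T) l`,
`Q_{T,k} = cube T 0`, `ε Q^l_d = cube ε l` and `Q^n_k = cube 1 n`. -/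
def cube {n : ℕ} (s : ℝ) (l : Fin n → ℤ) : Set (Space n) :=
  {x | ∀ m, s * l m ≤ x m ∧ x m < s * (l m + 1)}

/-- The index `l` of the cube `cube s l` that contains `x`, for `s > 0`. -/
def cubeIndex {n : ℕ} (s : ℝ) (x : Space n) : Fin n → ℤ := fun m => ⌊x m / s⌋

theorem mem_cube_iff {n : ℕ} {s : ℝ} (hs : 0 < s) (l : Fin n → ℤ) (x : Space n) :
    x ∈ cube s l ↔ cubeIndex s x = l := by
  simp only [cube, cubeIndex, Set.mem_ofPred_eq, funext_iff, Int.floor_eq_iff, le_div_iff₀ hs,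
    div_lt_iff₀ hs, mul_comm s]

/-- The point `s l ∈ ℝⁿ` for `l ∈ ℤⁿ`. -/
def latticePoint {n : ℕ} (s : ℝ) (l : Fin n → ℤ) : Space n :=
  WithLp.toLp 2 fun m => s * (l m : ℝ)

open scoped Classical in
/-- The finite set of nodes `(Q^l_{T,d} × Q_{T,k}) ∩ X`. -/
def cellNodes {d k : ℕ} (T : ℕ) (X : Set (Node d k)) (l : Fin d → ℤ) : Finset (Node d k) :=
  ((Fintype.piFinset fun m => Finset.Ico ((T : ℤ) * l m) ((T : ℤ) * (l m + 1))) ×ˢ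
    (Fintype.piFinset fun _ => Finset.Ico (0 : ℤ) (T : ℤ))).filter (· ∈ X)

/-- The average of `u` over the nodes of the cell of index `l`. -/
def cellAverage {d k : ℕ} (T : ℕ) (X : Set (Node d k)) (u : Node d k → ℝ) (l : Fin d → ℤ) : ℝ :=
  ((cellNodes T X l).card : ℝ)⁻¹ * ∑ i ∈ cellNodes T X l, u i

open scoped Classical in
/-- The coarse-grained function: it is the cell average of index `l` on every cube
`ε Q^l_{T,d}` contained in `Ω`, and it is `0` on all the other cubes. -/
def coarse {d k : ℕ} (T : ℕ) (X : Set (Node d k)) (Ω : Set (Space d)) (ε : ℝ)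
    (u : Node d k → ℝ) (x : Space d) : ℝ :=
  if cube (ε * T) (cubeIndex (ε * T) x) ⊆ Ω then
    cellAverage T X u (cubeIndex (ε * T) x) else 0

/-- The piecewise-constant interpolation: it is `u i` on `ε Q^{i^d}_d × Q^{i^k}_k`. -/
def interpolation {d k : ℕ} (ε : ℝ) (u : Node d k → ℝ) (x : Space d × Space k) : ℝ :=
  u (cubeIndex ε x.1, cubeIndex 1 x.2)

/-- The union over `i ∈ X` of the cells `ε Q^{i^d}_d × Q^{i^k}_k`. -/
def perforatedSet {d k : ℕ} (X : Set (Node d k)) (ε : ℝ) : Set (Space d × Space k) :=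
  ⋃ i ∈ X, cube ε i.1 ×ˢ cube 1 i.2

/-- The indices `l` such that `ε T l` is a point of `Ω` whose distance from the boundary of `Ω`
is larger than `2 ε √d T` (the distance from the empty set is infinite). -/
def innerIndices {d : ℕ} (T : ℕ) (Ω : Set (Space d)) (ε : ℝ) : Set (Fin d → ℤ) :=
  {l | latticePoint (ε * T) l ∈ Ω ∧
    ENNReal.ofReal (2 * ε * Real.sqrt d * T) <
      Metric.infEDist (latticePoint (ε * T) l) (frontier Ω)}

/-- The thin domain, in the variables in which its thickness is `T`: the union of the sets
`ε Q^l_{T,d} × Q_{T,k}` over the inner indices `l`. -/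
def thinDomain {d : ℕ} (k : ℕ) (T : ℕ) (Ω : Set (Space d)) (ε : ℝ) : Set (Space d × Space k) :=
  ⋃ l ∈ innerIndices T Ω ε, cube (ε * T) l ×ˢ cube (T : ℝ) 0

/-- The squared discrete `L²` norm `∑_{l} ∑_{i} ε^d |u_i|²`, over the inner cells. -/
def discreteNormSq {d k : ℕ} (T : ℕ) (X : Set (Node d k)) (Ω : Set (Space d)) (ε : ℝ)
    (u : Node d k → ℝ) : ℝ≥0∞ :=
  ∑' l : innerIndices T Ω ε, ∑ i ∈ cellNodes T X l, ENNReal.ofReal (ε ^ d * |u i| ^ 2)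

/-- The energy `∑_{i,j ∈ Y} ε^d a_{ij} ((u_i - u_j) / ε)²` of the nodes in `Y`. -/
def energy {d k : ℕ} (Y : Set (Node d k)) (a : Node d k → Node d k → ℝ) (ε : ℝ)
    (u : Node d k → ℝ) : ℝ≥0∞ :=
  ∑' (i : Y) (j : Y), ENNReal.ofReal (ε ^ d * a i j * ((u i - u j) / ε) ^ 2)

/-- The nodes `i ∈ X` such that `ε i^d ∈ Ω`. -/
def nodesOver {d k : ℕ} (X : Set (Node d k)) (Ω : Set (Space d)) (ε : ℝ) : Set (Node d k) :=
  {i ∈ X | latticePoint ε i.1 ∈ Ω}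

/-- Lipschitz boundary: near each of its boundary points, and after a choice of the vertical
direction `ν`, the set is the part above the graph of a Lipschitz function of the component
orthogonal to `ν`. -/
def HasLipschitzBoundary {d : ℕ} (Ω : Set (Space d)) : Prop :=
  ∀ x₀ ∈ frontier Ω, ∃ (ν : Space d) (r : ℝ) (K : ℝ≥0) (γ : Space d → ℝ),
    ‖ν‖ = 1 ∧ 0 < r ∧ LipschitzWith K γ ∧
    ∀ y ∈ Metric.ball x₀ r, y ∈ Ω ↔ γ (y - inner ℝ ν y • ν) < inner ℝ ν y

/-- Membership in the Sobolev space `H¹(Ω)`, where `g` is the weak gradient of `w`. -/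
def MemH1 {d : ℕ} (Ω : Set (Space d)) (w : Space d → ℝ) : Prop :=
  MemLp w 2 (volume.restrict Ω) ∧ ∃ g : Space d → Space d, MemLp g 2 (volume.restrict Ω) ∧
    ∀ φ : Space d → ℝ, ContDiff ℝ ∞ φ → HasCompactSupport φ → tsupport φ ⊆ Ω →
      ∀ v : Space d,
        ∫ x in Ω, w x * fderiv ℝ φ x v = - ∫ x in Ω, inner ℝ (g x) v * φ x

/-- Convergence in `L²_loc(Ω)`. -/
def TendstoL2Loc {d : ℕ} (Ω : Set (Space d)) (f : ℕ → Space d → ℝ) (w : Space d → ℝ) : Prop :=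
  ∀ K : Set (Space d), IsCompact K → K ⊆ Ω →
    Tendsto (fun n => eLpNorm (fun x => f n x - w x) 2 (volume.restrict K)) atTop (𝓝 0)

/-- The integral of `|u_ε - w|²` over the points of `D` which lie in one of the cells
`ε Q^{i^d}_d × Q^{i^k}_k`, `i ∈ X`. -/
def perforatedError {d k : ℕ} (X : Set (Node d k)) (D : Set (Space d × Space k)) (ε : ℝ)
    (u : Node d k → ℝ) (w : Space d → ℝ) : ℝ≥0∞ :=
  ∫⁻ x in D, (perforatedSet X ε).indicator
    (fun x => ENNReal.ofReal (|interpolation ε u x - w x.1| ^ 2)) x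

/-- Along the sequence `ε n → 0` the coarse-grained functions tend to `w` in `L²_loc(Ω)` and the
original functions tend to `w` on the part of the thin domain occupied by the cells of `X`: on
the whole thin domain if `Ω` is bounded, and always on its part over any bounded set. -/
def PerforatedConvergence {d k : ℕ} (T : ℕ) (X : Set (Node d k)) (Ω : Set (Space d))
    (ε : ℕ → ℝ) (u : ℕ → Node d k → ℝ) (w : Space d → ℝ) : Prop :=
  TendstoL2Loc Ω (fun n => coarse T X Ω (ε n) (u n)) w ∧
  (Bornology.IsBounded Ω → Tendsto
    (fun n => perforatedError X (thinDomain k T Ω (ε n)) (ε n) (u n) w) atTop (𝓝 0)) ∧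
  ∀ B : Set (Space d), Bornology.IsBounded B → Tendsto
    (fun n => perforatedError X (thinDomain k T Ω (ε n) ∩ Prod.fst ⁻¹' B) (ε n) (u n) w)
    atTop (𝓝 0)

end

/-!
Write `s = ε S` for the side of the cells, where `S` is the period in use. The proof separates the
network from the analysis.

*Network.* A node can be moved towards another one by translations of length `T`, and by
periodicity there are only finitely many paths between a node and its neighbouring translates.
This gives the inequality `IsThinNetwork.exists_pairEnergy_le`: the difference of the values at two
nodes is controlled by the energy of the edges within a distance `ρ` of the box spanned by the two
nodes, where `ρ` depends on the network only. Hence the averages over neighbouring cells, and the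
values inside of a cell, differ by an amount controlled by the energy near these cells. When only
the interactions over `Ω` are available, the paths have to stay over `Ω`; as inner cells keep the
distance `2 √d s` from the boundary, it suffices that `4 ρ ≤ S`, which is the role of the larger
period. Both parts of the theorem are thus instances of
`IsThinNetwork.exists_perforatedConvergence`.

*Analysis.* The cell averages and their difference quotients on inner cells, extended by zero, are
bounded in `L²(ℝᵈ)` and converge weakly along a subsequence; summation by parts shows that the weak
limit `w` lies in `H¹(Ω)` (`integral_mul_fderiv_eq_neg`). Strong convergence is needed up to the
boundary, on all the inner cells, without an extension operator. It comes from a one-sided version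
of the Fréchet–Kolmogorov argument (`tendsto_lintegral_of_translations`): it is enough to compare
the functions with their averages over translations by a small set `D` of vectors. Near a boundary
point `D` is a ball in the cone of directions that point into the Lipschitz domain
(`HasLipschitzBoundary.exists_cone`). Moving the corner of an inner cell along such a vector, in
steps that are small compared to `s`, never comes closer to the boundary, so that all the
differences met on the way are controlled, and the end point lies in an inner cell again
(`CellControl.sq_sub_le`). Summing over the cells gives a translation estimate that is uniform up
to the boundary (`CellControl.lintegral_translate_sub_le`).
-/

/-! ### Paths and energies in a periodic network -/

/-- The translate `i + T v` of a node by the multiple `T v` of a horizontal lattice vector. -/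
def nodeTranslate {d k : ℕ} (T : ℕ) (v : Fin d → ℤ) (i : Node d k) : Node d k :=
  (i.1 + fun m => (T : ℤ) * v m, i.2)

/-- The energy density `ε^d ((u_i - u_j) / ε)²` of a pair of nodes, without its coefficient. -/
noncomputable def pairEnergy {d k : ℕ} (ε : ℝ) (u : Node d k → ℝ) (i j : Node d k) : ℝ≥0∞ :=
  ENNReal.ofReal (ε ^ d * ((u i - u j) / ε) ^ 2)

/-- The nodes whose horizontal part lies within distance `ρ`, in the sup norm, of the box
spanned by `i` and `j`. -/
def boxAround {d k : ℕ} (ρ : ℕ) (i j : Node d k) : Set (Node d k) :=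
  {q | ∀ m, min (i.1 m) (j.1 m) - ρ ≤ q.1 m ∧ q.1 m ≤ max (i.1 m) (j.1 m) + ρ}

/-- The nodes whose horizontal part lies within distance `M`, in the sup norm, of `S l`. -/
def window {d : ℕ} (k M S : ℕ) (l : Fin d → ℤ) : Set (Node d k) :=
  {q | ∀ m, |(S : ℤ) * l m - q.1 m| ≤ M}

section Network

variable {d k : ℕ}

theorem energy_eq_tsum_indicator (Y : Set (Node d k)) (a : Node d k → Node d k → ℝ) (ε : ℝ)
    (u : Node d k → ℝ) :
    energy Y a ε u = ∑' (i : Node d k) (j : Node d k), Y.indicator (fun i => Y.indicator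
      (fun j => ENNReal.ofReal (ε ^ d * a i j * ((u i - u j) / ε) ^ 2)) j) i := by
  classical
  unfold energy
  rw [tsum_subtype Y (fun i => ∑' j : Y, ENNReal.ofReal (ε ^ d * a i j * ((u i - u j) / ε) ^ 2))]
  refine tsum_congr fun i => ?_
  by_cases hi : i ∈ Y
  · simp only [indicator_of_mem hi]
    rw [tsum_subtype Y (fun j => ENNReal.ofReal (ε ^ d * a i j * ((u i - u j) / ε) ^ 2))]
  · simp [indicator_of_notMem hi]

theorem energy_mono {Y Z : Set (Node d k)} (h : Y ⊆ Z) (a : Node d k → Node d k → ℝ) (ε : ℝ)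
    (u : Node d k → ℝ) : energy Y a ε u ≤ energy Z a ε u := by
  rw [energy_eq_tsum_indicator, energy_eq_tsum_indicator]
  refine ENNReal.tsum_le_tsum fun i => ENNReal.tsum_le_tsum fun j => ?_
  refine (indicator_le_indicator_of_subset h (fun _ => zero_le) i).trans ?_
  refine indicator_le_indicator (indicator_le_indicator_of_subset h (fun _ => zero_le) j)

theorem le_energy {Y : Set (Node d k)} (a : Node d k → Node d k → ℝ) (ε : ℝ)
    (u : Node d k → ℝ) {i j : Node d k} (hi : i ∈ Y) (hj : j ∈ Y) :
    ENNReal.ofReal (ε ^ d * a i j * ((u i - u j) / ε) ^ 2) ≤ energy Y a ε u := by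
  unfold energy
  exact (ENNReal.le_tsum (f := fun j : Y => ENNReal.ofReal
    (ε ^ d * a i j * ((u i - u j) / ε) ^ 2)) ⟨j, hj⟩).trans
    (ENNReal.le_tsum (f := fun i : Y => ∑' j : Y, ENNReal.ofReal
    (ε ^ d * a i j * ((u i - u j) / ε) ^ 2)) ⟨i, hi⟩)

theorem pairEnergy_comm (ε : ℝ) (u : Node d k → ℝ) (i j : Node d k) :
    pairEnergy ε u i j = pairEnergy ε u j i := by
  unfold pairEnergy; congr 1; ring

theorem pairEnergy_self (ε : ℝ) (u : Node d k → ℝ) (i : Node d k) : pairEnergy ε u i i = 0 := by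
  simp [pairEnergy]

theorem pairEnergy_triangle {ε : ℝ} (hε : 0 < ε) (u : Node d k → ℝ) (i j l : Node d k) :
    pairEnergy ε u i l ≤ 2 * pairEnergy ε u i j + 2 * pairEnergy ε u j l := by
  unfold pairEnergy
  rw [← ENNReal.ofReal_ofNat, ← ENNReal.ofReal_mul (by norm_num),
    ← ENNReal.ofReal_mul (by norm_num), ← ENNReal.ofReal_add (by positivity) (by positivity)]
  refine ENNReal.ofReal_le_ofReal ?_
  have h : ((u i - u l) / ε) ^ 2 ≤ 2 * ((u i - u j) / ε) ^ 2 + 2 * ((u j - u l) / ε) ^ 2 := by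
    have : (u i - u l) / ε = (u i - u j) / ε + (u j - u l) / ε := by ring
    rw [this]
    nlinarith [sq_nonneg ((u i - u j) / ε - (u j - u l) / ε)]
  have := mul_le_mul_of_nonneg_left h (pow_pos hε d).le
  nlinarith

/-- An edge of positive coefficient controls the difference of the values at its end points. -/
theorem pairEnergy_le_of_coeff_pos {Y : Set (Node d k)} {a : Node d k → Node d k → ℝ} {ε : ℝ}
    (u : Node d k → ℝ) {i j : Node d k} (hi : i ∈ Y) (hj : j ∈ Y) (h : 0 < a i j) :
    pairEnergy ε u i j ≤ ((a i j)⁻¹.toNNReal : ℝ≥0) * energy Y a ε u := by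
  refine le_trans ?_ (mul_le_mul_right (le_energy a ε u hi hj) _)
  unfold pairEnergy
  rw [← ENNReal.ofReal, ← ENNReal.ofReal_mul (inv_pos.2 h).le]
  refine ENNReal.ofReal_le_ofReal (le_of_eq ?_)
  field_simp

theorem nodeTranslate_zero (T : ℕ) (i : Node d k) : nodeTranslate T 0 i = i := by
  ext m <;> simp [nodeTranslate]

theorem nodeTranslate_add (T : ℕ) (v w : Fin d → ℤ) (i : Node d k) :
    nodeTranslate T (v + w) i = nodeTranslate T w (nodeTranslate T v i) := by
  ext m <;> simp [nodeTranslate]; ring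

theorem shift_nodeTranslate (T : ℕ) (v : Fin d → ℤ) (m : Fin d) (i : Node d k) :
    shift T m (nodeTranslate T v i) = nodeTranslate T (v + Pi.single m 1) i := by
  ext n
  · by_cases h : n = m
    · subst h; simp [nodeTranslate, shift]; ring
    · simp [nodeTranslate, shift, h]
  · simp [nodeTranslate, shift]

/-- A property of integer vectors that is invariant under the unit translations and holds at the
origin holds everywhere. -/
theorem forall_of_single_invariant {P : (Fin d → ℤ) → Prop} (h0 : P 0)
    (h : ∀ v m, P (v + Pi.single m 1) ↔ P v) (v : Fin d → ℤ) : P v := by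
  have h1 : ∀ (m : Fin d) (n : ℤ) v, P (v + Pi.single m n) ↔ P v := by
    intro m n
    induction n using Int.induction_on with
    | zero => simp
    | succ n ih =>
      intro v
      rw [Pi.single_add, ← add_assoc, h, ih]
    | pred n ih =>
      intro v
      rw [← h _ m, add_assoc, ← Pi.single_add, sub_add_cancel, ih]
  have h2 : ∀ s : Finset (Fin d), P (∑ m ∈ s, Pi.single m (v m)) := by
    classical
    intro s
    induction s using Finset.induction_on with
    | empty => simpa using h0
    | insert m s hm ih => rw [Finset.sum_insert hm, add_comm, h1]; exact ih
  simpa [Finset.univ_sum_single] using h2 Finset.univ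

namespace IsThinNetwork

variable {T : ℕ} {X : Set (Node d k)} {E : Set (Node d k × Node d k)}
  {a : Node d k → Node d k → ℝ}

theorem nodeTranslate_mem_iff (hX : IsThinNetwork T X E a) (v : Fin d → ℤ) (i : Node d k) :
    nodeTranslate T v i ∈ X ↔ i ∈ X := by
  refine forall_of_single_invariant (P := fun v => nodeTranslate T v i ∈ X ↔ i ∈ X)
    (by simp [nodeTranslate_zero]) (fun v m => ?_) v
  rw [← shift_nodeTranslate, hX.periodic]

theorem coeff_nodeTranslate (hX : IsThinNetwork T X E a) (v : Fin d → ℤ) {i j : Node d k}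
    (hi : i ∈ X) (hj : j ∈ X) : a (nodeTranslate T v i) (nodeTranslate T v j) = a i j := by
  refine forall_of_single_invariant
    (P := fun v => a (nodeTranslate T v i) (nodeTranslate T v j) = a i j)
    (by simp [nodeTranslate_zero]) (fun v m => ?_) v
  rw [← shift_nodeTranslate, ← shift_nodeTranslate,
    hX.coeff_periodic _ ((hX.nodeTranslate_mem_iff _ _).2 hi) _
      ((hX.nodeTranslate_mem_iff _ _).2 hj)]

/-- Two given nodes are joined by a path; the path and its translates control the difference of
the values at the end points. -/
theorem exists_pairEnergy_le_of_mem (hX : IsThinNetwork T X E a) {i j : Node d k} (hi : i ∈ X)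
    (hj : j ∈ X) : ∃ (ρ : ℕ) (C : ℝ≥0), ∀ (v : Fin d → ℤ) (ε : ℝ) (u : Node d k → ℝ), 0 < ε →
      pairEnergy ε u (nodeTranslate T v i) (nodeTranslate T v j) ≤ C * energy
        {q ∈ X | ∀ m, |q.1 m - (nodeTranslate T v i).1 m| ≤ ρ} a ε u := by
  induction hX.connected i hi j hj with
  | refl => exact ⟨0, 0, fun v ε u _ => by simp [pairEnergy_self]⟩
  | @tail p q hip hpq ih =>
    have hmem : p ∈ X ∧ q ∈ X := by
      rcases hpq with h | h
      · exact hX.edges_subset _ _ h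
      · exact (hX.edges_subset _ _ h).symm
    obtain ⟨ρ, C, h⟩ := ih hmem.1
    obtain ⟨ρ', hρ'⟩ : ∃ ρ' : ℕ, ∀ m, |p.1 m - i.1 m| ≤ ρ' ∧ |q.1 m - i.1 m| ≤ ρ' := by
      refine ⟨∑ m, ((p.1 m - i.1 m).natAbs + (q.1 m - i.1 m).natAbs), fun m => ?_⟩
      have := Finset.single_le_sum (f := fun m => (p.1 m - i.1 m).natAbs +
        (q.1 m - i.1 m).natAbs) (fun _ _ => Nat.zero_le _) (Finset.mem_univ m)
      simp only [Int.abs_eq_natAbs]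
      omega
    -- the last edge of the path may be run through in either direction
    obtain ⟨b, hb⟩ : ∃ b : ℝ≥0, ∀ (v : Fin d → ℤ) (ε : ℝ) (u : Node d k → ℝ)
        (Y : Set (Node d k)), nodeTranslate T v p ∈ Y → nodeTranslate T v q ∈ Y →
        pairEnergy ε u (nodeTranslate T v p) (nodeTranslate T v q) ≤ b * energy Y a ε u := by
      rcases hpq with he | he
      · refine ⟨(a p q)⁻¹.toNNReal, fun v ε u Y hp hq => ?_⟩
        rw [← hX.coeff_nodeTranslate v hmem.1 hmem.2]
        refine pairEnergy_le_of_coeff_pos u hp hq ?_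
        rw [hX.coeff_nodeTranslate v hmem.1 hmem.2]
        exact hX.coeff_pos _ hmem.1 _ hmem.2 he
      · refine ⟨(a q p)⁻¹.toNNReal, fun v ε u Y hp hq => ?_⟩
        rw [pairEnergy_comm, ← hX.coeff_nodeTranslate v hmem.2 hmem.1]
        refine pairEnergy_le_of_coeff_pos u hq hp ?_
        rw [hX.coeff_nodeTranslate v hmem.2 hmem.1]
        exact hX.coeff_pos _ hmem.2 _ hmem.1 he
    refine ⟨max ρ ρ', 2 * C + 2 * b, fun v ε u hε => ?_⟩
    set Y := {q ∈ X | ∀ m, |q.1 m - (nodeTranslate T v i).1 m| ≤ (max ρ ρ' : ℕ)}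
    refine (pairEnergy_triangle hε u _ (nodeTranslate T v p) _).trans ?_
    push_cast
    rw [add_mul, mul_assoc, mul_assoc]
    gcongr
    · refine (h v ε u hε).trans ?_
      gcongr
      refine energy_mono ?_ a ε u
      rintro q ⟨hq, hq'⟩
      exact ⟨hq, fun m => (hq' m).trans (by exact_mod_cast le_max_left _ _)⟩
    · refine hb v ε u Y ?_ ?_
      · refine ⟨(hX.nodeTranslate_mem_iff _ _).2 hmem.1, fun m => ?_⟩
        have := (hρ' m).1.trans (b := (ρ' : ℤ)) (c := (max ρ ρ' : ℕ))
          (by exact_mod_cast le_max_right _ _)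
        simpa [nodeTranslate] using this
      · refine ⟨(hX.nodeTranslate_mem_iff _ _).2 hmem.2, fun m => ?_⟩
        have := (hρ' m).2.trans (b := (ρ' : ℤ)) (c := (max ρ ρ' : ℕ))
          (by exact_mod_cast le_max_right _ _)
        simpa [nodeTranslate] using this

/-- By periodicity there are only finitely many pairs of nodes at distance at most `T`, up to
translation: the paths between them have a common range. -/
theorem exists_pairEnergy_le_of_near (hX : IsThinNetwork T X E a) (hT : 1 ≤ T) :
    ∃ (ρ : ℕ) (C : ℝ≥0), ∀ i ∈ X, ∀ j ∈ X, (∀ m, |i.1 m - j.1 m| ≤ T) →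
      ∀ (ε : ℝ) (u : Node d k → ℝ), 0 < ε → pairEnergy ε u i j ≤
        C * energy {q ∈ X | ∀ m, |q.1 m - i.1 m| ≤ ρ} a ε u := by
  classical
  have hfin : {q ∈ X | ∀ m, |q.1 m| ≤ 2 * T}.Finite := by
    refine Set.Finite.subset (Set.Finite.prod (Set.Finite.pi' (ι := Fin d)
      (t := fun _ => Set.Icc (-(2 * T : ℤ)) (2 * T)) fun _ => Set.finite_Icc _ _)
      (Set.Finite.pi' (ι := Fin k) (t := fun _ => Set.Icc (0 : ℤ) T)
        fun _ => Set.finite_Icc _ _)) ?_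
    rintro q ⟨hq, hq'⟩
    exact ⟨fun m => abs_le.1 (hq' m), fun n => ⟨(hX.bounded q hq n).1, (hX.bounded q hq n).2.le⟩⟩
  choose! ρ C h using fun i hi j hj => hX.exists_pairEnergy_le_of_mem (i := i) (j := j) hi hj
  set F := hfin.toFinset
  refine ⟨∑ i ∈ F, ∑ j ∈ F, ρ i j, ∑ i ∈ F, ∑ j ∈ F, C i j, fun i hi j hj hij ε u hε => ?_⟩
  have hT' : (0 : ℤ) < T := by exact_mod_cast hT
  -- the translation by `-c` takes `i` into the cell `[0, T)^d`, and `j` next to it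
  set c : Fin d → ℤ := fun m => i.1 m / T
  have hmem : ∀ p ∈ X, (∀ m, |i.1 m - p.1 m| ≤ T) → nodeTranslate T (-c) p ∈ F := by
    intro p hp hip
    simp only [F, Set.Finite.mem_toFinset]
    refine ⟨(hX.nodeTranslate_mem_iff _ _).2 hp, fun m => ?_⟩
    have h1 := Int.emod_add_mul_ediv (i.1 m) T
    have h2 := Int.emod_nonneg (i.1 m) hT'.ne'
    have h3 := Int.emod_lt_of_pos (i.1 m) hT'
    have h4 := abs_le.1 (hip m)
    simp only [nodeTranslate, Pi.add_apply, Pi.neg_apply, c]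
    rw [abs_le]
    constructor <;> nlinarith
  have hi0 := hmem i hi (by simp)
  have hj0 := hmem j hj hij
  have htr : ∀ p : Node d k, nodeTranslate T c (nodeTranslate T (-c) p) = p := by
    intro p; rw [← nodeTranslate_add]; simp [nodeTranslate_zero]
  have key := h _ ((hX.nodeTranslate_mem_iff (-c) i).2 hi) _
    ((hX.nodeTranslate_mem_iff (-c) j).2 hj)
    c ε u hε
  rw [htr, htr] at key
  refine key.trans ?_
  gcongr
  · exact (Finset.single_le_sum (f := fun j => C (nodeTranslate T (-c) i) j)
      (fun _ _ => zero_le) hj0).trans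
      (Finset.single_le_sum (f := fun i => ∑ j ∈ F, C i j) (fun _ _ => zero_le) hi0)
  · refine energy_mono ?_ a ε u
    rintro q ⟨hq, hq'⟩
    refine ⟨hq, fun m => (hq' m).trans ?_⟩
    exact_mod_cast (Finset.single_le_sum (f := fun j => ρ (nodeTranslate T (-c) i) j)
      (fun _ _ => zero_le) hj0).trans
      (Finset.single_le_sum (f := fun i => ∑ j ∈ F, ρ i j) (fun _ _ => zero_le) hi0)

/-- A Poincaré inequality along paths. Two nodes are joined by moving one of them towards the
other by translations of length `T`, so that the path stays within a fixed distance `ρ` of the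
box spanned by the two nodes; only the constant depends on their distance. -/
theorem exists_pairEnergy_le (hX : IsThinNetwork T X E a) (hT : 1 ≤ T) :
    ∃ ρ : ℕ, ∀ n : ℕ, ∃ C : ℝ≥0, ∀ i ∈ X, ∀ j ∈ X, ∑ m, |i.1 m - j.1 m| ≤ n →
      ∀ (ε : ℝ) (u : Node d k → ℝ), 0 < ε →
        pairEnergy ε u i j ≤ C * energy (X ∩ boxAround ρ i j) a ε u := by
  obtain ⟨ρ, C₀, h₀⟩ := hX.exists_pairEnergy_le_of_near hT
  have hnear : ∀ i j : Node d k, {q ∈ X | ∀ m, |q.1 m - i.1 m| ≤ ρ} ⊆ X ∩ boxAround ρ i j := by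
    rintro i j q ⟨hq, hq'⟩
    refine ⟨hq, fun m => ?_⟩
    have := abs_le.1 (hq' m)
    have h1 := min_le_left (i.1 m) (j.1 m)
    have h2 := le_max_left (i.1 m) (j.1 m)
    constructor <;> linarith
  have hT' : (1 : ℤ) ≤ T := by exact_mod_cast hT
  -- each translation decreases the distance, at the price of a larger constant
  refine ⟨ρ, fun n => ?_⟩
  induction n with
  | zero =>
    refine ⟨C₀, fun i hi j hj hij ε u hε => ?_⟩
    refine (h₀ i hi j hj (fun m => ?_) ε u hε).trans
      (by gcongr; exact energy_mono (hnear i j) a ε u)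
    have := (Finset.single_le_sum (f := fun m => |i.1 m - j.1 m|) (fun _ _ => abs_nonneg _)
      (Finset.mem_univ m)).trans hij
    push_cast at this
    linarith
  | succ n ih =>
    obtain ⟨C, hC⟩ := ih
    refine ⟨2 * C₀ + 2 * C, fun i hi j hj hij ε u hε => ?_⟩
    by_cases hsmall : ∀ m, |i.1 m - j.1 m| ≤ T
    · refine (h₀ i hi j hj hsmall ε u hε).trans ?_
      gcongr
      · have : C₀ ≤ 2 * C₀ + 2 * C := by
          rw [two_mul, add_assoc]; exact le_self_add
        exact this
      · exact energy_mono (hnear i j) a ε u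
    · push Not at hsmall
      obtain ⟨m, hm⟩ := hsmall
      obtain ⟨σ, hσ, hσ'⟩ : ∃ σ : ℤ, |σ| = 1 ∧
          ((σ = 1 ∧ i.1 m + T < j.1 m) ∨ (σ = -1 ∧ j.1 m + T < i.1 m)) := by
        rcases lt_abs.1 hm with h | h
        · exact ⟨-1, by simp, Or.inr ⟨rfl, by linarith⟩⟩
        · exact ⟨1, by simp, Or.inl ⟨rfl, by linarith⟩⟩
      set i' := nodeTranslate T (Pi.single m σ) i with hi'
      have hi'X : i' ∈ X := (hX.nodeTranslate_mem_iff _ _).2 hi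
      have hval : ∀ p, p ≠ m → i'.1 p = i.1 p := by
        intro p hp; simp [hi', nodeTranslate, hp]
      have hvalm : i'.1 m = i.1 m + T * σ := by simp [hi', nodeTranslate]
      refine (pairEnergy_triangle hε u i i' j).trans ?_
      push_cast
      rw [add_mul, mul_assoc, mul_assoc]
      gcongr
      · refine (h₀ i hi i' hi'X (fun p => ?_) ε u hε).trans
          (by gcongr; exact energy_mono (hnear i j) a ε u)
        by_cases hp : p = m
        · subst hp
          rw [hvalm, sub_add_cancel_left, abs_neg, abs_mul, hσ]
          simp
        · rw [hval p hp]; simp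
      · refine (hC i' hi'X j hj ?_ ε u hε).trans ?_
        · have hlt : ∑ p, |i'.1 p - j.1 p| < ∑ p, |i.1 p - j.1 p| := by
            refine Finset.sum_lt_sum (fun p _ => ?_) ⟨m, Finset.mem_univ _, ?_⟩
            · by_cases hp : p = m
              · subst hp
                rw [hvalm]
                rcases hσ' with ⟨rfl, h⟩ | ⟨rfl, h⟩
                · rw [abs_of_nonpos (by linarith), abs_of_nonpos (by linarith)]; linarith
                · rw [abs_of_nonneg (by linarith), abs_of_nonneg (by linarith)]; linarith
              · rw [hval p hp]
            · rw [hvalm]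
              rcases hσ' with ⟨rfl, h⟩ | ⟨rfl, h⟩
              · rw [abs_of_nonpos (by linarith), abs_of_nonpos (by linarith)]; linarith
              · rw [abs_of_nonneg (by linarith), abs_of_nonneg (by linarith)]; linarith
          push_cast at hij
          linarith
        · gcongr
          refine energy_mono (inter_subset_inter_right _ fun q hq p => ?_) a ε u
          have := hq p
          by_cases hp : p = m
          · subst hp
            rw [hvalm] at this
            rcases hσ' with ⟨rfl, h⟩ | ⟨rfl, h⟩ <;> constructor <;> omega
          · rwa [hval p hp] at this

end IsThinNetwork

/-- Every edge lies in a bounded number of windows. -/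
theorem tsum_energy_window_le (M : ℕ) {S : ℕ} (hS : 1 ≤ S) :
    ∃ N : ℝ≥0, ∀ (Y : Set (Node d k)) (a : Node d k → Node d k → ℝ) (ε : ℝ) (u : Node d k → ℝ),
      ∑' l, energy (Y ∩ window k M S l) a ε u ≤ N * energy Y a ε u := by
  classical
  set B : Finset (Fin d → ℤ) := Fintype.piFinset fun _ => Finset.Icc (-(M : ℤ)) M
  have hcount : ∀ (p : Node d k) (c : ℝ≥0∞),
      ∑' l, (window k M S l).indicator (fun _ => c) p ≤ (B.card : ℝ≥0) * c := by
    intro p c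
    have hinj : Function.Injective fun (l : Fin d → ℤ) (m : Fin d) => (S : ℤ) * l m - p.1 m := by
      intro l l' h
      funext m
      have := congrFun h m
      have hS' : (S : ℤ) ≠ 0 := by positivity
      exact mul_left_cancel₀ hS' (by simpa using this)
    have := ENNReal.tsum_comp_le_tsum_of_injective hinj
      (fun z => (B : Set (Fin d → ℤ)).indicator (fun _ => c) z)
    calc ∑' l, (window k M S l).indicator (fun _ => c) p
        = ∑' l : Fin d → ℤ, (B : Set (Fin d → ℤ)).indicator (fun _ => c)
            (fun m => (S : ℤ) * l m - p.1 m) := by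
          refine tsum_congr fun l => ?_
          simp only [indicator_apply]
          congr 1
          simp only [window, Set.mem_ofPred_eq, B, Finset.mem_coe, Fintype.mem_piFinset,
            Finset.mem_Icc, abs_le]
      _ ≤ ∑' z, (B : Set (Fin d → ℤ)).indicator (fun _ => c) z := this
      _ = (B.card : ℝ≥0) * c := by
          rw [← tsum_subtype, Finset.tsum_subtype' B fun _ => c]
          simp
  refine ⟨B.card, fun Y a ε u => ?_⟩
  simp_rw [energy_eq_tsum_indicator]
  rw [ENNReal.tsum_comm, ← ENNReal.tsum_mul_left]
  refine ENNReal.tsum_le_tsum fun p => ?_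
  rw [ENNReal.tsum_comm, ← ENNReal.tsum_mul_left]
  refine ENNReal.tsum_le_tsum fun q => ?_
  refine le_trans (ENNReal.tsum_le_tsum fun l => ?_) (hcount p _)
  simp only [indicator_apply, mem_inter_iff]
  split_ifs <;> simp_all

end Network

/-! ### Weak and strong convergence in `L²`, and functions constant on cubes -/

section Tools

theorem eLpNorm_two_sq {α : Type*} {_ : MeasurableSpace α} (μ : Measure α) (f : α → ℝ) :
    eLpNorm f 2 μ ^ 2 = ∫⁻ x, ‖f x‖ₑ ^ 2 ∂μ := by
  have := eLpNorm_nnreal_pow_eq_lintegral (μ := μ) (f := f) (p := 2) (by norm_num)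
  simpa using this

theorem tendsto_eLpNorm_two_zero {α : Type*} {_ : MeasurableSpace α} {μ : Measure α}
    {f : ℕ → α → ℝ} (h : Tendsto (fun n => ∫⁻ x, ‖f n x‖ₑ ^ 2 ∂μ) atTop (𝓝 0)) :
    Tendsto (fun n => eLpNorm (f n) 2 μ) atTop (𝓝 0) := by
  have h2 := (ENNReal.continuous_rpow_const (y := 1 / 2)).tendsto 0 |>.comp h
  rw [ENNReal.zero_rpow_of_pos (by norm_num)] at h2
  refine h2.congr fun n => ?_
  simp only [Function.comp_apply]
  rw [← eLpNorm_two_sq, ← ENNReal.rpow_natCast, ← ENNReal.rpow_mul]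
  norm_num

theorem enorm_sq_eq_ofReal (x : ℝ) : ‖x‖ₑ ^ 2 = ENNReal.ofReal (x ^ 2) := by
  rw [← sq_abs, ENNReal.ofReal_pow (abs_nonneg x), Real.enorm_eq_ofReal_abs]

/-- The triangle inequality for squares, in the form used to insert an intermediate value. -/
theorem enorm_sub_sq_le (x y z : ℝ) : ‖x - z‖ₑ ^ 2 ≤ 2 * ‖x - y‖ₑ ^ 2 + 2 * ‖y - z‖ₑ ^ 2 := by
  simp only [enorm_sq_eq_ofReal]
  rw [← ENNReal.ofReal_ofNat, ← ENNReal.ofReal_mul (by norm_num),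
    ← ENNReal.ofReal_mul (by norm_num), ← ENNReal.ofReal_add (by positivity) (by positivity)]
  exact ENNReal.ofReal_le_ofReal (by nlinarith [sq_nonneg (x - y - (y - z))])

/-- A bounded sequence of `L²` has a weakly convergent subsequence. -/
theorem exists_weakly_convergent_subseq {α : Type*} {_ : MeasurableSpace α} {μ : Measure α}
    [IsSeparable μ] {f : ℕ → α → ℝ} (hf : ∀ n, MemLp (f n) 2 μ) {C : ℝ≥0}
    (hC : ∀ n, eLpNorm (f n) 2 μ ≤ C) :
    ∃ φ : ℕ → ℕ, StrictMono φ ∧ ∃ w : α → ℝ, StronglyMeasurable w ∧ MemLp w 2 μ ∧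
      ∀ g, MemLp g 2 μ →
        Tendsto (fun n => ∫ x, f (φ n) x * g x ∂μ) atTop (𝓝 (∫ x, w x * g x ∂μ)) := by
  have : Fact ((2 : ℝ≥0∞) ≠ ⊤) := ⟨by norm_num⟩
  set F : ℕ → Lp ℝ 2 μ := fun n => (hf n).toLp (f n)
  set D := InnerProductSpace.toDual ℝ (Lp ℝ 2 μ)
  have hmem : ∀ n, StrongDual.toWeakDual (D (F n)) ∈
      WeakDual.toStrongDual ⁻¹' Metric.closedBall (0 : StrongDual ℝ (Lp ℝ 2 μ)) C := by
    intro n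
    simp only [mem_preimage, mem_closedBall_zero_iff]
    have : ‖D (F n)‖ ≤ C := by
      rw [LinearIsometryEquiv.norm_map, Lp.norm_toLp]
      exact ENNReal.toReal_le_coe_of_le_coe (hC n)
    exact this
  obtain ⟨L, -, φ, hφ, hL⟩ := WeakDual.isSeqCompact_closedBall ℝ (Lp ℝ 2 μ) 0 C hmem
  obtain ⟨W, hW⟩ := D.surjective (WeakDual.toStrongDual L)
  refine ⟨φ, hφ, W, Lp.stronglyMeasurable W, Lp.memLp W, fun g hg => ?_⟩
  have hinner : ∀ V : Lp ℝ 2 μ, D V (hg.toLp g) = ∫ x, V x * g x ∂μ := by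
    intro V
    rw [InnerProductSpace.toDual_apply_apply, L2.inner_def]
    refine integral_congr_ae ?_
    filter_upwards [hg.coeFn_toLp] with x hx
    rw [hx]
    simp [mul_comm]
  have h1 := ((WeakDual.eval_continuous (𝕜 := ℝ) (hg.toLp g)).tendsto L).comp hL
  have h2 : L (hg.toLp g) = ∫ x, W x * g x ∂μ := by
    rw [← hinner, hW]; rfl
  rw [h2] at h1
  refine h1.congr fun n => ?_
  change D (F (φ n)) (hg.toLp g) = _
  rw [hinner]
  refine integral_congr_ae ?_
  filter_upwards [(hf (φ n)).coeFn_toLp] with x hx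
  rw [hx]

/-- Finitely many bounded sequences of `L²` converge weakly along a common subsequence. -/
theorem exists_common_weakly_convergent_subseq {α ι : Type*} [Fintype ι] {_ : MeasurableSpace α}
    {μ : Measure α} [IsSeparable μ] {f : ι → ℕ → α → ℝ} (hf : ∀ i n, MemLp (f i n) 2 μ)
    {C : ℝ≥0} (hC : ∀ i n, eLpNorm (f i n) 2 μ ≤ C) :
    ∃ φ : ℕ → ℕ, StrictMono φ ∧ ∀ i, ∃ w : α → ℝ, StronglyMeasurable w ∧ MemLp w 2 μ ∧
      ∀ g, MemLp g 2 μ →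
        Tendsto (fun n => ∫ x, f i (φ n) x * g x ∂μ) atTop (𝓝 (∫ x, w x * g x ∂μ)) := by
  classical
  suffices h : ∀ s : Finset ι, ∃ φ : ℕ → ℕ, StrictMono φ ∧ ∀ i ∈ s, ∃ w : α → ℝ,
      StronglyMeasurable w ∧ MemLp w 2 μ ∧ ∀ g, MemLp g 2 μ →
        Tendsto (fun n => ∫ x, f i (φ n) x * g x ∂μ) atTop (𝓝 (∫ x, w x * g x ∂μ)) by
    obtain ⟨φ, hφ, h⟩ := h Finset.univ
    exact ⟨φ, hφ, fun i => h i (Finset.mem_univ i)⟩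
  intro s
  induction s using Finset.induction_on with
  | empty => exact ⟨id, strictMono_id, by simp⟩
  | insert i s his ih =>
    obtain ⟨φ, hφ, h⟩ := ih
    obtain ⟨ψ, hψ, h'⟩ := exists_weakly_convergent_subseq (f := fun n => f i (φ n))
      (fun n => hf i _) (fun n => hC i _)
    refine ⟨φ ∘ ψ, hφ.comp hψ, fun j hj => ?_⟩
    rcases Finset.mem_insert.1 hj with rfl | hj
    · exact h'
    · obtain ⟨w, hw, hw2, hlim⟩ := h j hj
      exact ⟨w, hw, hw2, fun g hg => (hlim g hg).comp hψ.tendsto_atTop⟩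

/-- Continuity of the translations in `L²`. -/
theorem tendsto_lintegral_translate_sub {n : ℕ} {w : Space n → ℝ} (hw : MemLp w 2 volume) :
    Tendsto (fun h => ∫⁻ x, ‖w (x + h) - w x‖ₑ ^ 2) (𝓝 0) (𝓝 0) := by
  have : Fact ((2 : ℝ≥0∞) ≠ ⊤) := ⟨by norm_num⟩
  set W : Lp ℝ 2 (volume : Measure (Space n)) := hw.toLp w
  have hcont : Continuous fun h : Space n => DomAddAct.mk h +ᵥ W :=
    (DomAddAct.continuous_mk).vadd continuous_const
  have h1 : Tendsto (fun h : Space n => edist (DomAddAct.mk h +ᵥ W) W) (𝓝 0) (𝓝 0) := by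
    have := (hcont.edist (continuous_const (y := W))).tendsto (0 : Space n)
    simpa using this
  have h2 : Tendsto (fun h : Space n => edist (DomAddAct.mk h +ᵥ W) W ^ 2) (𝓝 0) (𝓝 0) := by
    simpa using ENNReal.Tendsto.pow (n := 2) h1
  refine h2.congr fun h => ?_
  rw [DomAddAct.mk_vadd_toLp, Lp.edist_toLp_toLp, eLpNorm_two_sq]
  simp [add_comm]

/-- Jensen's inequality for the square of an average. -/
theorem enorm_sub_average_sq_le {α : Type*} {_ : MeasurableSpace α} {P : Measure α}
    [IsProbabilityMeasure P] {f : α → ℝ} (hf : Integrable f P) (c : ℝ) :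
    ‖c - ∫ h, f h ∂P‖ₑ ^ 2 ≤ ∫⁻ h, ‖f h - c‖ₑ ^ 2 ∂P := by
  have h0 : ∫ h, (f h - c) ∂P = ∫ h, f h ∂P - c := by
    rw [integral_sub hf (integrable_const c)]; simp
  have hm : AEStronglyMeasurable (fun h => f h - c) P :=
    hf.aestronglyMeasurable.sub aestronglyMeasurable_const
  calc ‖c - ∫ h, f h ∂P‖ₑ ^ 2 = ‖∫ h, (f h - c) ∂P‖ₑ ^ 2 := by
        rw [h0, ← enorm_neg]; congr 2; ring
    _ ≤ (∫⁻ h, ‖f h - c‖ₑ ∂P) ^ 2 := by gcongr; exact enorm_integral_le_lintegral_enorm _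
    _ ≤ eLpNorm (fun h => f h - c) 2 P ^ 2 := by
        gcongr
        rw [← eLpNorm_one_eq_lintegral_enorm]
        exact eLpNorm_le_eLpNorm_of_exponent_le (by norm_num) hm
    _ = _ := eLpNorm_two_sq _ _

theorem measurable_cubeIndex {n : ℕ} (s : ℝ) : Measurable (cubeIndex (n := n) s) := by
  refine measurable_pi_lambda _ fun m => Int.measurable_floor.comp ?_
  exact ((EuclideanSpace.proj (𝕜 := ℝ) m).continuous.measurable).div_const s

theorem volume_cube {n : ℕ} {s : ℝ} (hs : 0 < s) (l : Fin n → ℤ) :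
    volume (cube s l) = ENNReal.ofReal (s ^ n) := by
  have h1 : cube s l = WithLp.ofLp ⁻¹'
      (Set.univ.pi fun m => Set.Ico (s * l m : ℝ) (s * (l m + 1))) := by
    ext x; simp [cube]
  rw [h1, (PiLp.volume_preserving_ofLp (Fin n)).measure_preimage
    (MeasurableSet.univ_pi fun m => measurableSet_Ico).nullMeasurableSet, Real.volume_pi_Ico]
  simp [mul_add, ENNReal.ofReal_pow hs.le]

theorem lintegral_comp_cubeIndex {n : ℕ} {s : ℝ} (hs : 0 < s) (g : (Fin n → ℤ) → ℝ≥0∞) :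
    ∫⁻ x, g (cubeIndex s x) = ENNReal.ofReal (s ^ n) * ∑' l, g l := by
  rw [← lintegral_map (μ := volume) (measurable_of_countable g) (measurable_cubeIndex s),
    lintegral_countable', ← ENNReal.tsum_mul_left]
  refine tsum_congr fun l => ?_
  rw [Measure.map_apply (measurable_cubeIndex s) (measurableSet_singleton l)]
  have : cubeIndex s ⁻¹' {l} = cube s l := by
    ext x; rw [mem_cube_iff hs]; rfl
  rw [this, volume_cube hs, mul_comm]

/-- A local form of the Fréchet–Kolmogorov criterion. If the averages of `v n` over translations
from arbitrarily small sets `D` of vectors approximate `v n` on `A n`, uniformly in `n`, then weak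
convergence improves to strong convergence on `A n`. -/
theorem tendsto_lintegral_of_translations {d : ℕ} {v : ℕ → Space d → ℝ} {w : Space d → ℝ}
    (hvm : ∀ n, Measurable (v n)) (hv : ∀ n, MemLp (v n) 2 volume) {C : ℝ≥0}
    (hC : ∀ n, eLpNorm (v n) 2 volume ≤ C)
    (hwm : Measurable w) (hw : MemLp w 2 volume)
    (hlim : ∀ g, MemLp g 2 volume →
      Tendsto (fun n => ∫ x, v n x * g x) atTop (𝓝 (∫ x, w x * g x)))
    {A : ℕ → Set (Space d)} {B : Set (Space d)} (hAB : ∀ n, A n ⊆ B) (hB : volume B ≠ ⊤)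
    (h : ∀ η : ℝ, 0 < η → ∃ D : Set (Space d), MeasurableSet D ∧ volume D ≠ 0 ∧
      D ⊆ Metric.ball 0 η ∧ ∀ᶠ n in atTop, ∀ z ∈ D,
        ∫⁻ x in A n, ‖v n (x + z) - v n x‖ₑ ^ 2 ≤ ENNReal.ofReal η) :
    Tendsto (fun n => ∫⁻ x in A n, ‖v n x - w x‖ₑ ^ 2) atTop (𝓝 0) := by
  rw [ENNReal.tendsto_nhds_zero]
  intro τ hτ
  obtain ⟨η, hη, hητ, hητ'⟩ : ∃ η : ℝ, 0 < η ∧ ENNReal.ofReal η ≤ τ / 8 ∧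
      ∀ z : Space d, z ∈ Metric.ball 0 η → ∫⁻ x, ‖w (x + z) - w x‖ₑ ^ 2 ≤ τ / 8 := by
    have hτ8 : 0 < τ / 8 := ENNReal.div_pos hτ.ne' (by norm_num)
    obtain ⟨η₁, h1, h1'⟩ := Metric.eventually_nhds_iff_ball.1
      (ENNReal.tendsto_nhds_zero.1 (tendsto_lintegral_translate_sub hw) _ hτ8)
    obtain ⟨η₂, h2, h2'⟩ := ENNReal.lt_iff_exists_nnreal_btwn.1 hτ8
    refine ⟨min η₁ η₂, lt_min h1 (by exact_mod_cast h2), ?_, fun z hz => h1' z ?_⟩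
    · refine (ENNReal.ofReal_le_ofReal (min_le_right _ _)).trans ?_
      rw [ENNReal.ofReal_coe_nnreal]; exact h2'.le
    · exact Metric.ball_subset_ball (min_le_left _ _) hz
  obtain ⟨D, hDm, hD0, hDη, hD⟩ := h η hη
  have hDfin : volume D ≠ ⊤ :=
    ((measure_mono hDη).trans_lt measure_ball_lt_top).ne
  set P := ProbabilityTheory.cond volume D with hP
  have hPprob : IsProbabilityMeasure P :=
    ProbabilityTheory.cond_isProbabilityMeasure_of_finite hD0 hDfin
  -- averages are integrals against translates of the indicator function of `D`
  have hind : ∀ x : Space d, MemLp (D.indicator (fun _ => (1 : ℝ)) ∘ fun y => y - x) 2 volume :=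
    fun x => (memLp_indicator_const 2 hDm 1 (Or.inr hDfin)).comp_measurePreserving
      (measurePreserving_sub_right volume x)
  have hintg : ∀ f : Space d → ℝ, MemLp f 2 volume → ∀ x, Integrable (fun z => f (x + z)) P := by
    intro f hf x
    have h1 : MemLp (fun z => f (x + z)) 2 volume :=
      hf.comp_measurePreserving (measurePreserving_add_left volume x)
    have h2 : MemLp (fun z => f (x + z)) 2 P := by
      rw [hP, ProbabilityTheory.cond]
      exact (h1.restrict D).smul_measure (ENNReal.inv_ne_top.2 hD0)
    exact h2.integrable (by norm_num)
  have havg : ∀ (f : Space d → ℝ) (x : Space d), ∫ z, f (x + z) ∂P =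
      (volume D)⁻¹.toReal * ∫ y, f y * (D.indicator (fun _ => (1 : ℝ)) ∘ fun y => y - x) y := by
    intro f x
    rw [hP, ProbabilityTheory.cond, integral_smul_measure, smul_eq_mul, ← integral_indicator hDm,
      ← integral_add_left_eq_self (μ := volume) (fun y => f y * _) x]
    congr 2
    funext z
    by_cases hz : z ∈ D <;> simp [hz]
  -- pointwise convergence and a uniform bound for the averages
  have hpt : ∀ x, Tendsto (fun n => ∫ z, v n (x + z) ∂P) atTop (𝓝 (∫ z, w (x + z) ∂P)) := by
    intro x
    simp_rw [havg]
    exact (hlim _ (hind x)).const_mul _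
  have hbd : ∀ (f : Space d → ℝ), MemLp f 2 volume → ∀ x,
      ‖∫ z, f (x + z) ∂P‖ₑ ^ 2 ≤ (volume D)⁻¹ * eLpNorm f 2 volume ^ 2 := by
    intro f hf x
    have h1 := enorm_sub_average_sq_le (hintg f hf x) 0
    simp only [zero_sub, enorm_neg, sub_zero] at h1
    refine h1.trans ?_
    rw [hP, ProbabilityTheory.cond, lintegral_smul_measure, smul_eq_mul, eLpNorm_two_sq]
    refine mul_le_mul_right ((setLIntegral_le_lintegral _ _).trans (le_of_eq ?_)) _
    exact lintegral_add_left_eq_self (fun y => ‖f y‖ₑ ^ 2) x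
  have hmeas : ∀ f : Space d → ℝ, Measurable f → Measurable fun x => ∫ z, f (x + z) ∂P := by
    intro f hf
    have : StronglyMeasurable (Function.uncurry fun (x : Space d) (z : Space d) => f (x + z)) :=
      (hf.comp (measurable_fst.add measurable_snd)).stronglyMeasurable
    exact (this.integral_prod_right (ν := P)).measurable
  have hdom : Tendsto (fun n => ∫⁻ x in B, ‖∫ z, v n (x + z) ∂P - ∫ z, w (x + z) ∂P‖ₑ ^ 2)
      atTop (𝓝 0) := by
    have := tendsto_lintegral_of_dominated_convergence (μ := volume.restrict B)
      (F := fun n x => ‖∫ z, v n (x + z) ∂P - ∫ z, w (x + z) ∂P‖ₑ ^ 2) (f := fun _ => 0)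
      (fun _ => 2 * ((volume D)⁻¹ * C ^ 2) + 2 * ((volume D)⁻¹ * eLpNorm w 2 volume ^ 2))
      (fun n => ((hmeas _ (hvm n)).sub (hmeas _ hwm)).enorm.pow_const 2)
      (fun n => Eventually.of_forall fun x => ?_) ?_ (Eventually.of_forall fun x => ?_)
    · simpa using this
    · refine (enorm_sub_sq_le _ 0 _).trans ?_
      simp only [sub_zero, zero_sub, enorm_neg]
      gcongr
      · refine (hbd _ (hv n) x).trans ?_
        gcongr
        exact hC n
      · exact hbd _ hw x
    · have h1 : (volume D)⁻¹ ≠ ⊤ := ENNReal.inv_ne_top.2 hD0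
      have h2 := hw.eLpNorm_ne_top
      rw [lintegral_const, Measure.restrict_apply_univ]
      finiteness
    · have h1 := ((hpt x).sub_const (∫ z, w (x + z) ∂P)).enorm
      rw [sub_self, enorm_zero] at h1
      simpa using ENNReal.Tendsto.pow (n := 2) h1
  have hswap : ∀ (f : Space d → ℝ), Measurable f → MemLp f 2 volume → ∀ (K : Set (Space d))
      (c : ℝ≥0∞), (∀ z ∈ D, ∫⁻ x in K, ‖f (x + z) - f x‖ₑ ^ 2 ≤ c) →
      ∫⁻ x in K, ‖f x - ∫ z, f (x + z) ∂P‖ₑ ^ 2 ≤ c := by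
    intro f hfm hf K c hc
    calc ∫⁻ x in K, ‖f x - ∫ z, f (x + z) ∂P‖ₑ ^ 2
        ≤ ∫⁻ x in K, ∫⁻ z, ‖f (x + z) - f x‖ₑ ^ 2 ∂P :=
          lintegral_mono fun x => enorm_sub_average_sq_le (hintg f hf x) (f x)
      _ = ∫⁻ z, (∫⁻ x in K, ‖f (x + z) - f x‖ₑ ^ 2) ∂P := by
          have hmeas2 : Measurable (Function.uncurry fun x z => ‖f (x + z) - f x‖ₑ ^ 2) :=
            (((hfm.comp (measurable_fst.add measurable_snd)).sub
            (hfm.comp measurable_fst)).enorm.pow_const 2)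
          exact lintegral_lintegral_swap hmeas2.aemeasurable
      _ ≤ ∫⁻ z, c ∂P := by
          have hae : ∀ᵐ z ∂P, (∫⁻ x in K, ‖f (x + z) - f x‖ₑ ^ 2) ≤ c := by
            filter_upwards [ProbabilityTheory.ae_cond_mem hDm] with z hz using hc z hz
          exact lintegral_mono_ae hae
      _ = c := by simp
  have hτ16 : 0 < τ / 16 := ENNReal.div_pos hτ.ne' (by norm_num)
  filter_upwards [hD, ENNReal.tendsto_nhds_zero.1 hdom _ hτ16] with n hn hn'
  have hw' : ∫⁻ x, ‖∫ z, w (x + z) ∂P - w x‖ₑ ^ 2 ≤ τ / 8 := by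
    have := hswap w hwm hw univ (τ / 8) fun z hz => by
      rw [Measure.restrict_univ]; exact hητ' z (hDη hz)
    rw [Measure.restrict_univ] at this
    refine le_trans (le_of_eq (lintegral_congr fun x => ?_)) this
    rw [← enorm_neg, neg_sub]
  have hv' := (hswap (v n) (hvm n) (hv n) (A n) _ hn).trans hητ
  have hm1 : Measurable fun x => ‖v n x - ∫ z, v n (x + z) ∂P‖ₑ ^ 2 :=
    ((hvm n).sub (hmeas _ (hvm n))).enorm.pow_const 2
  have hm2 : Measurable fun x => ‖∫ z, v n (x + z) ∂P - ∫ z, w (x + z) ∂P‖ₑ ^ 2 :=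
    ((hmeas _ (hvm n)).sub (hmeas _ hwm)).enorm.pow_const 2
  calc ∫⁻ x in A n, ‖v n x - w x‖ₑ ^ 2
      ≤ ∫⁻ x in A n, (2 * ‖v n x - ∫ z, v n (x + z) ∂P‖ₑ ^ 2 +
          (4 * ‖∫ z, v n (x + z) ∂P - ∫ z, w (x + z) ∂P‖ₑ ^ 2 +
            4 * ‖∫ z, w (x + z) ∂P - w x‖ₑ ^ 2)) := by
        refine lintegral_mono fun x => ?_
        refine (enorm_sub_sq_le _ (∫ z, v n (x + z) ∂P) _).trans ?_
        gcongr
        refine (mul_le_mul_right (enorm_sub_sq_le _ (∫ z, w (x + z) ∂P) _) 2).trans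
          (le_of_eq ?_)
        ring
    _ = 2 * (∫⁻ x in A n, ‖v n x - ∫ z, v n (x + z) ∂P‖ₑ ^ 2) +
          (4 * (∫⁻ x in A n, ‖∫ z, v n (x + z) ∂P - ∫ z, w (x + z) ∂P‖ₑ ^ 2) +
            4 * ∫⁻ x in A n, ‖∫ z, w (x + z) ∂P - w x‖ₑ ^ 2) := by
        rw [lintegral_add_left (hm1.const_mul 2), lintegral_const_mul _ hm1,
          lintegral_add_left (hm2.const_mul 4), lintegral_const_mul _ hm2,
          lintegral_const_mul' _ _ (by norm_num)]
    _ ≤ 2 * (τ / 8) + (4 * (τ / 16) + 4 * (τ / 8)) := by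
        gcongr
        · exact (lintegral_mono_set (hAB n)).trans hn'
        · exact (setLIntegral_le_lintegral _ _).trans hw'
    _ = τ := by
        by_cases hτt : τ = ⊤
        · subst hτt; simp [ENNReal.top_div]
        lift τ to ℝ≥0 using hτt
        have h8 : ((8 : ℝ≥0) : ℝ≥0∞) = 8 := rfl
        have h16 : ((16 : ℝ≥0) : ℝ≥0∞) = 16 := rfl
        have h2 : ((2 : ℝ≥0) : ℝ≥0∞) = 2 := rfl
        have h4 : ((4 : ℝ≥0) : ℝ≥0∞) = 4 := rfl
        rw [← h8, ← h16, ← h2, ← h4, ← ENNReal.coe_div (by norm_num),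
          ← ENNReal.coe_div (by norm_num)]
        norm_cast
        rw [← NNReal.coe_inj]
        push_cast
        ring

end Tools

/-! ### Inner cells and the cone property -/

/-- The union of the inner cubes, described by the index of the cube that contains a point. -/
def innerSet {d : ℕ} (T : ℕ) (Ω : Set (Space d)) (ε : ℝ) : Set (Space d) :=
  {x | cubeIndex (ε * T) x ∈ innerIndices T Ω ε}

/-- The function that is `f l` on the inner cube of index `l`, extended by `0`. -/
noncomputable def innerValue {d : ℕ} (T : ℕ) (Ω : Set (Space d)) (ε : ℝ) (f : (Fin d → ℤ) → ℝ) :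
    Space d → ℝ :=
  (innerSet T Ω ε).indicator fun x => f (cubeIndex (ε * T) x)

/-- The weight `e l` controls the difference quotients of `f` between `l` and the cells `l'` next
to it, as long as both cells are close to the centre `y` of a ball of radius `2 √d s` contained
in `Ω`, where `s = ε T` is the side of the cells. The bound `5/4` leaves a margin of `s/4` for
steps that are not lattice vectors, and still a margin in the ball for the paths in the network. -/
def CellControl {d : ℕ} (T : ℕ) (Ω : Set (Space d)) (ε : ℝ) (f : (Fin d → ℤ) → ℝ)
    (e : (Fin d → ℤ) → ℝ≥0∞) : Prop :=
  ∀ (l l' : Fin d → ℤ) (y : Space d), Metric.ball y (2 * Real.sqrt d * (ε * T)) ⊆ Ω →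
    (∀ m, y m - 5 / 4 * (ε * T) ≤ ε * T * l m ∧ ε * T * (l m + 1) ≤ y m + 5 / 4 * (ε * T)) →
    (∀ m, y m - 5 / 4 * (ε * T) ≤ ε * T * l' m ∧ ε * T * (l' m + 1) ≤ y m + 5 / 4 * (ε * T)) →
    ENNReal.ofReal ((ε * T) ^ d * ((f l - f l') / (ε * T)) ^ 2) ≤ e l

section Geometry

variable {d : ℕ}

theorem norm_le_sqrt_mul {x : Space d} {c : ℝ} (hc : 0 ≤ c) (h : ∀ m, |x m| ≤ c) :
    ‖x‖ ≤ Real.sqrt d * c := by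
  rw [EuclideanSpace.norm_eq, ← Real.sqrt_sq hc, ← Real.sqrt_mul (by positivity)]
  refine Real.sqrt_le_sqrt ?_
  calc ∑ m, ‖x m‖ ^ 2 ≤ ∑ _m : Fin d, c ^ 2 := by
        refine Finset.sum_le_sum fun m _ => ?_
        rw [Real.norm_eq_abs]
        exact pow_le_pow_left₀ (abs_nonneg _) (h m) 2
    _ = d * c ^ 2 := by simp

theorem mul_cubeIndex_le {s : ℝ} (hs : 0 < s) (x : Space d) (m : Fin d) :
    s * cubeIndex s x m ≤ x m := by
  have := Int.floor_le (x m / s)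
  rw [le_div_iff₀ hs] at this
  rw [mul_comm]; exact this

theorem lt_mul_cubeIndex {s : ℝ} (hs : 0 < s) (x : Space d) (m : Fin d) :
    x m < s * (cubeIndex s x m + 1) := by
  have := Int.lt_floor_add_one (x m / s)
  rw [div_lt_iff₀ hs] at this
  rw [mul_comm]; exact this

theorem norm_sub_latticePoint_le {s : ℝ} (hs : 0 < s) (x : Space d) :
    ‖x - latticePoint s (cubeIndex s x)‖ ≤ Real.sqrt d * s := by
  refine norm_le_sqrt_mul hs.le fun m => ?_
  have h1 := mul_cubeIndex_le hs x m
  have h2 := lt_mul_cubeIndex hs x m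
  simp only [PiLp.sub_apply, latticePoint]
  rw [abs_le]; constructor <;> linarith

theorem ball_subset_of_mem_innerIndices {T : ℕ} {Ω : Set (Space d)} {ε : ℝ} {l : Fin d → ℤ}
    (hl : l ∈ innerIndices T Ω ε) :
    Metric.ball (latticePoint (ε * T) l) (2 * Real.sqrt d * (ε * T)) ⊆ Ω := by
  obtain ⟨hp, hdist⟩ := hl
  set p : Space d := latticePoint (ε * T) l
  intro q hq
  by_contra hqΩ
  have hp' : p ∈ Metric.ball p (2 * Real.sqrt d * (ε * T)) :=
    Metric.mem_ball_self (dist_nonneg.trans_lt hq)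
  obtain ⟨z, hz, hzf⟩ : ∃ z ∈ Metric.ball p (2 * Real.sqrt d * (ε * T)), z ∈ frontier Ω := by
    by_contra! hno
    have hint : ∀ z ∈ Metric.ball p (2 * Real.sqrt d * (ε * T)), z ∈ closure Ω → z ∈ interior Ω :=
      fun z hz hzc => by_contra fun hzi => hno z hz ⟨hzc, hzi⟩
    obtain ⟨z, -, hz1, hz2⟩ := (convex_ball p (2 * Real.sqrt d * (ε * T))).isPreconnected
      (interior Ω) (closure Ω)ᶜ isOpen_interior isClosed_closure.isOpen_compl
      (fun z hz => or_iff_not_imp_right.2 fun hzc => hint z hz (not_not.1 hzc))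
      ⟨p, hp', hint p hp' (subset_closure hp)⟩
      ⟨q, hq, fun hqc => hqΩ (interior_subset (hint q hq hqc))⟩
    exact hz2 (interior_subset_closure hz1)
  have h1 := hdist.trans_le (Metric.infEDist_le_edist_of_mem hzf)
  rw [edist_dist, dist_comm] at h1
  have h2 := (ENNReal.ofReal_lt_ofReal_iff_of_nonneg (by
    have := dist_nonneg.trans_lt hq; nlinarith)).1 h1
  rw [Metric.mem_ball] at hz
  nlinarith

theorem mem_innerIndices_of_ball_subset {T : ℕ} {Ω : Set (Space d)} (hΩ : IsOpen Ω) {ε R : ℝ}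
    {l : Fin d → ℤ} (hε : 0 < ε) (hR : 2 * Real.sqrt d * (ε * T) < R)
    (h : Metric.ball (latticePoint (ε * T) l) R ⊆ Ω) : l ∈ innerIndices T Ω ε := by
  have hR0 : 0 < R := lt_of_le_of_lt (by positivity) hR
  refine ⟨h (Metric.mem_ball_self hR0), lt_of_lt_of_le (b := ENNReal.ofReal R) ?_
    (Metric.le_infEDist.2 fun z hz => ?_)⟩
  · exact (ENNReal.ofReal_lt_ofReal_iff hR0).2 (by nlinarith)
  · rw [edist_dist]
    refine ENNReal.ofReal_le_ofReal ?_
    by_contra hlt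
    have : z ∈ Ω := h (by rw [Metric.mem_ball, dist_comm]; linarith)
    rw [hΩ.frontier_eq] at hz
    exact hz.2 this

theorem mem_innerSet_of_ball_subset {T : ℕ} {Ω : Set (Space d)} (hΩ : IsOpen Ω) {ε R : ℝ}
    {x : Space d} (hε : 0 < ε) (hT : 1 ≤ T) (hR : 3 * Real.sqrt d * (ε * T) < R)
    (h : Metric.ball x R ⊆ Ω) : x ∈ innerSet T Ω ε := by
  have hs : 0 < ε * T := mul_pos hε (by exact_mod_cast hT)
  refine mem_innerIndices_of_ball_subset hΩ hε (R := R - Real.sqrt d * (ε * T)) (by linarith)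
    (subset_trans (Metric.ball_subset_ball' ?_) h)
  rw [dist_comm, dist_eq_norm]
  linarith [norm_sub_latticePoint_le hs x]

theorem innerSet_subset {T : ℕ} {Ω : Set (Space d)} {ε : ℝ} (hd : 1 ≤ d) (hε : 0 < ε)
    (hT : 1 ≤ T) {x y : Space d} (hx : x ∈ innerSet T Ω ε)
    (hxy : cubeIndex (ε * T) y = cubeIndex (ε * T) x) : y ∈ Ω := by
  have hs : 0 < ε * T := mul_pos hε (by exact_mod_cast hT)
  refine ball_subset_of_mem_innerIndices hx ?_
  have h1 := norm_sub_latticePoint_le hs y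
  have h2 : 0 < Real.sqrt d := Real.sqrt_pos.2 (by exact_mod_cast hd)
  rw [Metric.mem_ball, dist_eq_norm, ← hxy]
  nlinarith [mul_pos h2 hs]

theorem measurableSet_innerSet (T : ℕ) (Ω : Set (Space d)) (ε : ℝ) :
    MeasurableSet (innerSet T Ω ε) :=
  measurable_cubeIndex _ (Set.to_countable _).measurableSet

theorem measurable_innerValue (T : ℕ) (Ω : Set (Space d)) (ε : ℝ) (f : (Fin d → ℤ) → ℝ) :
    Measurable (innerValue T Ω ε f) :=
  ((measurable_of_countable f).comp (measurable_cubeIndex _)).indicator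
    (measurableSet_innerSet T Ω ε)

/-- The cone property of Lipschitz domains, local and including interior points: translations by
the vectors of a truncated cone around `ν` map the part of `Ω` near `x₀` into `Ω`. -/
theorem HasLipschitzBoundary.exists_cone {Ω : Set (Space d)} (hL : HasLipschitzBoundary Ω)
    (hΩ : IsOpen Ω) {x₀ : Space d} (hx₀ : x₀ ∈ closure Ω) :
    ∃ (ν : Space d) (r κ : ℝ), ‖ν‖ ≤ 1 ∧ 0 < r ∧ 0 < κ ∧ κ ≤ 1 ∧
      ∀ t, 0 < t → t ≤ r → ∀ z ∈ Metric.ball (t • ν) (t * κ), ∀ x ∈ Ω ∩ Metric.ball x₀ r,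
        x + z ∈ Ω := by
  by_cases hx : x₀ ∈ Ω
  · obtain ⟨R, hR, hball⟩ := Metric.isOpen_iff.1 hΩ x₀ hx
    refine ⟨0, R / 2, 1, by simp, by positivity, one_pos, le_rfl, fun t _ ht z hz x hx => hball ?_⟩
    have h1 := hx.2
    simp only [smul_zero, sub_zero, mul_one, Metric.mem_ball, dist_eq_norm] at hz h1 ⊢
    calc ‖x + z - x₀‖ = ‖(x - x₀) + z‖ := by congr 1; abel
      _ ≤ ‖x - x₀‖ + ‖z‖ := norm_add_le _ _
      _ < R := by linarith
  · have hfr : x₀ ∈ frontier Ω := by rw [hΩ.frontier_eq]; exact ⟨hx₀, hx⟩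
    obtain ⟨ν, r, K, γ, hν, hr, hγ, hgraph⟩ := hL x₀ hfr
    have hK : (0 : ℝ) < 1 + K := by positivity
    refine ⟨ν, r / 3, (1 + K)⁻¹, hν.le, by positivity, inv_pos.2 hK,
      inv_le_one_of_one_le₀ (by simp), fun t ht htr z hz x hx => ?_⟩
    have hκ1 : (1 + (K : ℝ))⁻¹ ≤ 1 := inv_le_one_of_one_le₀ (by simp)
    have hκ : K * (1 + (K : ℝ))⁻¹ = 1 - (1 + (K : ℝ))⁻¹ := by field_simp; ring
    set κ := (1 + (K : ℝ))⁻¹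
    set b := z - t • ν with hb
    have hbn : ‖b‖ < t * κ := by rwa [Metric.mem_ball, dist_eq_norm] at hz
    have hzb : z = t • ν + b := by rw [hb]; abel
    have hνν : inner ℝ ν ν = (1 : ℝ) := by rw [real_inner_self_eq_norm_sq, hν]; norm_num
    have hνb : |inner ℝ ν b| ≤ ‖b‖ := by
      have := abs_real_inner_le_norm ν b
      rwa [hν, one_mul] at this
    have hxr := hx.2
    rw [Metric.mem_ball, dist_eq_norm] at hxr
    have hzr : ‖z‖ ≤ 2 * t := by
      rw [hzb]
      refine (norm_add_le _ _).trans ?_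
      rw [norm_smul, hν, Real.norm_eq_abs, abs_of_pos ht]
      nlinarith
    have h1 := (hgraph x (by rw [Metric.mem_ball, dist_eq_norm]; linarith)).1 hx.1
    refine (hgraph (x + z) ?_).2 ?_
    · rw [Metric.mem_ball, dist_eq_norm]
      calc ‖x + z - x₀‖ = ‖(x - x₀) + z‖ := by congr 1; abel
        _ ≤ ‖x - x₀‖ + ‖z‖ := norm_add_le _ _
        _ < r := by linarith
    · have hz2 : inner ℝ ν z = t + inner ℝ ν b := by
        rw [hzb, inner_add_right, inner_smul_right, hνν, mul_one]
      have hperp : ‖b - inner ℝ ν b • ν‖ ≤ ‖b‖ := by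
        refine le_of_sq_le_sq ?_ (norm_nonneg _)
        rw [norm_sub_sq_real, norm_smul, hν, inner_smul_right, real_inner_comm ν b, mul_one,
          Real.norm_eq_abs, sq_abs]
        nlinarith [sq_nonneg (inner ℝ ν b)]
      have h2 := hγ.dist_le_mul (x + z - inner ℝ ν (x + z) • ν) (x - inner ℝ ν x • ν)
      have h3 : (x + z - inner ℝ ν (x + z) • ν) - (x - inner ℝ ν x • ν) =
          b - inner ℝ ν b • ν := by
        rw [inner_add_right, hz2, hzb]; module
      rw [Real.dist_eq, dist_eq_norm, h3] at h2
      have h4 := (abs_le.1 h2).2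
      have h5 : (K : ℝ) * ‖b - inner ℝ ν b • ν‖ ≤ K * (t * κ) := by gcongr; linarith
      have h6 := (abs_le.1 hνb).1
      rw [inner_add_right, hz2] at *
      nlinarith

end Geometry

/-! ### Translation estimates up to the boundary -/

section Translation

variable {d : ℕ}

/-- For adjacent cells with an inner upper corner `l'`, the point `y = s l'` can serve as the centre
of the ball. -/
theorem CellControl.le_of_adjacent {T : ℕ} {Ω : Set (Space d)} {ε : ℝ} {f : (Fin d → ℤ) → ℝ}
    {e : (Fin d → ℤ) → ℝ≥0∞} (hc : CellControl T Ω ε f e) (hs : 0 < ε * T) {l l' : Fin d → ℤ}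
    (hl' : l' ∈ innerIndices T Ω ε) (h : ∀ m, l m ≤ l' m ∧ l' m ≤ l m + 1) :
    ENNReal.ofReal ((ε * T) ^ d * ((f l - f l') / (ε * T)) ^ 2) ≤ e l := by
  refine hc l l' (latticePoint (ε * T) l') (ball_subset_of_mem_innerIndices hl') (fun m => ?_)
    fun m => ?_
  · have h1 : (l m : ℝ) ≤ l' m := by exact_mod_cast (h m).1
    have h2 : (l' m : ℝ) ≤ l m + 1 := by exact_mod_cast (h m).2
    simp only [latticePoint]
    constructor <;> nlinarith
  · simp only [latticePoint]
    constructor <;> nlinarith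

/-- The translation estimate at a single inner cube. The corner of the cube is moved along the
segment of direction `z`, which stays inside the domain by the cone property, in `N` steps of
length at most `s / 4`; the end point lies so deep in the domain that its cube is inner. -/
theorem CellControl.sq_sub_le {T : ℕ} {Ω : Set (Space d)} (hd : 1 ≤ d) (hΩ : IsOpen Ω)
    (hT : 1 ≤ T) {ε : ℝ} (hε : 0 < ε) {f : (Fin d → ℤ) → ℝ} {e : (Fin d → ℤ) → ℝ≥0∞}
    (hc : CellControl T Ω ε f e) {x₀ ν : Space d} {r κ : ℝ} (hν : ‖ν‖ ≤ 1) (hκ0 : 0 < κ)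
    (hκ1 : κ ≤ 1)
    (hcone : ∀ t, 0 < t → t ≤ r → ∀ z ∈ Metric.ball (t • ν) (t * κ), ∀ x ∈ Ω ∩ Metric.ball x₀ r,
      x + z ∈ Ω) {δ : ℝ} (hδ : 0 < δ) (hδr : δ ≤ r)
    (hs1 : 3 * Real.sqrt d * (ε * T) < r / 2) (hs2 : 2 * Real.sqrt d * (ε * T) < δ * κ / 2)
    {N : ℕ} (hN0 : 0 < N) (hN : 8 * δ ≤ N * (ε * T)) {z : Space d}
    (hz : z ∈ Metric.ball (δ • ν) (δ * κ / 2)) {x : Space d} (hxr : x ∈ Metric.ball x₀ (r / 2))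
    (hx : x ∈ innerSet T Ω ε) :
    x + z ∈ innerSet T Ω ε ∧
      ‖f (cubeIndex (ε * T) (x + z)) - f (cubeIndex (ε * T) x)‖ₑ ^ 2 ≤
        (N + 1) * (ENNReal.ofReal ((ε * T) ^ 2 / (ε * T) ^ d) * ∑ j ∈ Finset.range (N + 1),
          e (cubeIndex (ε * T) x + fun m => ⌊(j / N * z m) / (ε * T)⌋)) := by
  have hs : 0 < ε * T := mul_pos hε (by exact_mod_cast hT)
  set s := ε * T with hs_def
  set l := cubeIndex s x with hl
  set l' := cubeIndex s (x + z) with hl'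
  set p := latticePoint s l with hp
  have hN0' : (0 : ℝ) < N := by exact_mod_cast hN0
  have hd0 : 0 ≤ Real.sqrt d := Real.sqrt_nonneg _
  have hxp : ‖x - p‖ ≤ Real.sqrt d * s := norm_sub_latticePoint_le hs x
  have hball : Metric.ball p (2 * Real.sqrt d * s) ⊆ Ω := ball_subset_of_mem_innerIndices hx
  have hballr : Metric.ball p (2 * Real.sqrt d * s) ⊆ Metric.ball x₀ r := by
    refine Metric.ball_subset_ball' ?_
    have h1 := dist_triangle p x x₀
    rw [dist_comm p x, dist_eq_norm x p] at h1
    have := Metric.mem_ball.1 hxr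
    linarith
  have hzn : ‖z‖ ≤ 2 * δ := by
    have h1 := Metric.mem_ball.1 hz
    rw [dist_eq_norm] at h1
    have h2 := norm_add_le (z - δ • ν) (δ • ν)
    rw [sub_add_cancel, norm_smul, Real.norm_eq_abs, abs_of_pos hδ] at h2
    nlinarith
  -- the translates of the ball around the corner stay in the domain
  have hmove : ∀ θ : ℝ, 0 ≤ θ → θ ≤ 1 → Metric.ball (p + θ • z) (2 * Real.sqrt d * s) ⊆ Ω := by
    intro θ h0 h1 q hq
    rcases h0.eq_or_lt with rfl | h0
    · simpa using hball (by simpa using hq)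
    have hq' : q - θ • z ∈ Metric.ball p (2 * Real.sqrt d * s) := by
      rw [Metric.mem_ball, dist_eq_norm] at hq ⊢
      rwa [sub_sub, add_comm (θ • z)]
    have := hcone (θ * δ) (by positivity) (by nlinarith) (θ • z) ?_ (q - θ • z)
      ⟨hball hq', hballr hq'⟩
    · simpa using this
    · rw [Metric.mem_ball, dist_eq_norm] at hz ⊢
      rw [mul_smul, ← smul_sub, norm_smul, Real.norm_eq_abs, abs_of_pos h0, mul_assoc]
      gcongr
      linarith [mul_pos hδ hκ0]
  -- the end point gains the room `δ κ / 2`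
  -- because `z` may still be perturbed by `δ κ / 2` inside of the cone
  have hend : Metric.ball (p + z) (2 * Real.sqrt d * s + δ * κ / 2) ⊆ Ω := by
    intro q hq
    set a := 2 * Real.sqrt d * s with ha
    set b := δ * κ / 2 with hb
    have ha0 : 0 < a := mul_pos (mul_pos two_pos (Real.sqrt_pos.2 (by exact_mod_cast hd))) hs
    have hb0 : 0 < b := by positivity
    set y := q - (p + z) with hy
    have hyn : ‖y‖ < a + b := by rwa [Metric.mem_ball, dist_eq_norm] at hq
    have hab : 0 < a + b := by positivity
    have hq1 : p + (a / (a + b)) • y ∈ Metric.ball p a := by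
      rw [Metric.mem_ball, dist_eq_norm, add_sub_cancel_left, norm_smul, Real.norm_eq_abs,
        abs_of_pos (by positivity), div_mul_eq_mul_div, div_lt_iff₀ hab]
      gcongr
    have := hcone δ hδ hδr (z + (b / (a + b)) • y) ?_ _ ⟨hball hq1, hballr hq1⟩
    · have h1 : p + (a / (a + b)) • y + (z + (b / (a + b)) • y) = q := by
        have h2 : (a / (a + b)) • y + (b / (a + b)) • y = y := by
          rw [← add_smul, ← add_div, div_self hab.ne', one_smul]
        calc _ = p + z + ((a / (a + b)) • y + (b / (a + b)) • y) := by abel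
          _ = q := by rw [h2, hy]; abel
      rwa [h1] at this
    · have h3 : ‖(b / (a + b)) • y‖ < b := by
        rw [norm_smul, Real.norm_eq_abs, abs_of_pos (by positivity), div_mul_eq_mul_div,
          div_lt_iff₀ hab]
        gcongr
      rw [Metric.mem_ball, dist_eq_norm] at hz ⊢
      calc ‖z + (b / (a + b)) • y - δ • ν‖ = ‖(z - δ • ν) + (b / (a + b)) • y‖ := by
            congr 1; abel
        _ ≤ _ := norm_add_le _ _
        _ < δ * κ := by linarith
  have hinner : l' ∈ innerIndices T Ω ε := by
    refine mem_innerIndices_of_ball_subset hΩ hε (R := δ * κ / 2) hs2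
      (subset_trans (Metric.ball_subset_ball' ?_) hend)
    have h1 : dist (latticePoint s l') (p + z) ≤ Real.sqrt d * s := by
      rw [dist_eq_norm]
      refine norm_le_sqrt_mul hs.le fun m => ?_
      have h1 := mul_cubeIndex_le hs x m
      have h2 := lt_mul_cubeIndex hs x m
      have h3 := mul_cubeIndex_le hs (x + z) m
      have h4 := lt_mul_cubeIndex hs (x + z) m
      simp only [PiLp.sub_apply, PiLp.add_apply, latticePoint, p, l, l'] at h3 h4 ⊢
      rw [abs_le]; constructor <;> linarith
    nlinarith
  refine ⟨hinner, ?_⟩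
  -- the values met along the segment, and the value at the end
  set c : ℕ → Fin d → ℤ := fun j m => ⌊(j / N * z m) / s⌋ with hcdef
  have hcl : ∀ (j : ℕ) m, s * c j m ≤ j / N * z m ∧ j / N * z m < s * (c j m + 1) := by
    intro j m
    have h1 := Int.floor_le ((j / N * z m) / s)
    have h2 := Int.lt_floor_add_one ((j / N * z m) / s)
    rw [le_div_iff₀ hs] at h1
    rw [div_lt_iff₀ hs] at h2
    rw [mul_comm s, mul_comm s]
    exact ⟨h1, h2⟩
  set g : ℕ → ℝ := fun j => if j ≤ N then f (l + c j) else f l' with hg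
  have hstep : ∀ j ∈ Finset.range (N + 1),
      ENNReal.ofReal ((g (j + 1) - g j) ^ 2) ≤
        ENNReal.ofReal (s ^ 2 / s ^ d) * e (l + c j) := by
    intro j hj
    have hconv : ∀ A B : ℝ, ENNReal.ofReal ((A - B) ^ 2) = ENNReal.ofReal (s ^ 2 / s ^ d) *
        ENNReal.ofReal (s ^ d * ((B - A) / s) ^ 2) := by
      intro A B
      rw [← ENNReal.ofReal_mul (by positivity)]
      congr 1
      field_simp
      ring
    rw [hconv]
    gcongr
    have hjN : j ≤ N := Nat.lt_succ_iff.1 (Finset.mem_range.1 hj)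
    have hgj : g j = f (l + c j) := if_pos hjN
    rw [hgj]
    rcases hjN.eq_or_lt with rfl | hjN
    · have hgj' : g (j + 1) = f l' := if_neg (by omega)
      rw [hgj']
      refine hc.le_of_adjacent hs hinner fun m => ?_
      have h1 : c j m = ⌊z m / s⌋ := by
        simp only [hcdef]; rw [div_self hN0'.ne', one_mul]
      have h2 : l' m = ⌊x m / s + z m / s⌋ := by
        simp only [hl', cubeIndex, PiLp.add_apply, add_div]
      have h3 : l m = ⌊x m / s⌋ := rfl
      rw [Pi.add_apply, h1, h2, h3]
      exact ⟨Int.le_floor_add _ _, by linarith [Int.le_floor_add_floor (x m / s) (z m / s)]⟩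
    · have hgj' : g (j + 1) = f (l + c (j + 1)) := if_pos (by omega)
      rw [hgj']
      have hθ : (j : ℝ) / N ≤ 1 := by
        rw [div_le_one hN0']; exact_mod_cast hjN.le
      refine hc _ _ (p + ((j : ℝ) / N) • z) (hmove _ (by positivity) hθ) (fun m => ?_) fun m => ?_
      · obtain ⟨h1, h2⟩ := hcl j m
        simp only [PiLp.add_apply, PiLp.smul_apply, smul_eq_mul, p, latticePoint, Pi.add_apply,
          Int.cast_add]
        constructor <;> nlinarith
      · obtain ⟨h1, h2⟩ := hcl (j + 1) m
        have h3 : ((j + 1 : ℕ) : ℝ) / N * z m = j / N * z m + z m / N := by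
          push_cast; field_simp
        have h4 : |z m / N| ≤ s / 4 := by
          rw [abs_div, abs_of_pos hN0', div_le_iff₀ hN0']
          have := (PiLp.norm_apply_le z m).trans hzn
          rw [Real.norm_eq_abs] at this
          linarith
        have h5 := abs_le.1 h4
        rw [h3] at h1 h2
        simp only [PiLp.add_apply, PiLp.smul_apply, smul_eq_mul, p, latticePoint, Pi.add_apply,
          Int.cast_add]
        constructor <;> nlinarith
  have hg0 : g 0 = f l := by
    have : c 0 = 0 := by funext m; simp [hcdef]
    simp [hg, this]
  have hgN : g (N + 1) = f l' := if_neg (by omega)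
  rw [enorm_sq_eq_ofReal, ← hg0, ← hgN, ← Finset.sum_range_sub]
  have hcs := sq_sum_le_card_mul_sum_sq (s := Finset.range (N + 1))
    (f := fun j => g (j + 1) - g j)
  rw [Finset.card_range] at hcs
  refine (ENNReal.ofReal_le_ofReal hcs).trans ?_
  rw [ENNReal.ofReal_mul (by positivity), ENNReal.ofReal_sum_of_nonneg fun _ _ => sq_nonneg _,
    ENNReal.ofReal_natCast]
  push_cast
  refine (mul_le_mul_right (Finset.sum_le_sum hstep) _).trans (le_of_eq ?_)
  rw [← Finset.mul_sum]

/-- The translation estimate, uniform up to the boundary: translations by vectors `z` of length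
comparable to `δ` that point into the domain change the cell values, in `L²` and over all the
inner cells near `x₀`, by an amount of order `δ`. -/
theorem CellControl.lintegral_translate_sub_le {T : ℕ} {Ω : Set (Space d)} (hd : 1 ≤ d)
    (hΩ : IsOpen Ω)
    (hT : 1 ≤ T) {ε : ℝ} (hε : 0 < ε) {f : (Fin d → ℤ) → ℝ} {e : (Fin d → ℤ) → ℝ≥0∞}
    (hc : CellControl T Ω ε f e) {x₀ ν : Space d} {r κ : ℝ} (hν : ‖ν‖ ≤ 1) (hκ0 : 0 < κ)
    (hκ1 : κ ≤ 1)
    (hcone : ∀ t, 0 < t → t ≤ r → ∀ z ∈ Metric.ball (t • ν) (t * κ), ∀ x ∈ Ω ∩ Metric.ball x₀ r,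
      x + z ∈ Ω) {δ : ℝ} (hδ : 0 < δ) (hδr : δ ≤ r)
    (hs1 : 3 * Real.sqrt d * (ε * T) < r / 2) (hs2 : 2 * Real.sqrt d * (ε * T) < δ * κ / 2)
    (hs3 : ε * T ≤ δ) {z : Space d} (hz : z ∈ Metric.ball (δ • ν) (δ * κ / 2)) :
    ∫⁻ x in innerSet T Ω ε ∩ Metric.ball x₀ (r / 2),
        ‖innerValue T Ω ε f (x + z) - innerValue T Ω ε f x‖ₑ ^ 2 ≤
      ENNReal.ofReal (100 * δ ^ 2) * ∑' l, e l := by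
  have hs : 0 < ε * T := mul_pos hε (by exact_mod_cast hT)
  -- as `‖z‖ ≤ 2 δ`, the `N` steps of length `‖z‖ / N` are at most `s / 4`
  set N := ⌈8 * δ / (ε * T)⌉₊ with hNdef
  have hN0 : 0 < N := Nat.ceil_pos.2 (by positivity)
  have hN : 8 * δ ≤ N * (ε * T) := by
    have := Nat.le_ceil (8 * δ / (ε * T))
    rwa [div_le_iff₀ hs] at this
  have hN' : (N + 1 : ℝ) * (ε * T) ≤ 10 * δ := by
    have := Nat.ceil_lt_add_one (a := 8 * δ / (ε * T)) (by positivity)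
    rw [← hNdef, ← sub_lt_iff_lt_add, lt_div_iff₀ hs] at this
    nlinarith
  set G : (Fin d → ℤ) → ℝ≥0∞ := fun l => (N + 1) *
    (ENNReal.ofReal ((ε * T) ^ 2 / (ε * T) ^ d) * ∑ j ∈ Finset.range (N + 1),
      e (l + fun m => ⌊(j / N * z m) / (ε * T)⌋)) with hG
  calc ∫⁻ x in innerSet T Ω ε ∩ Metric.ball x₀ (r / 2),
        ‖innerValue T Ω ε f (x + z) - innerValue T Ω ε f x‖ₑ ^ 2
      ≤ ∫⁻ x in innerSet T Ω ε ∩ Metric.ball x₀ (r / 2), G (cubeIndex (ε * T) x) := by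
        refine setLIntegral_mono' ((measurableSet_innerSet _ _ _).inter measurableSet_ball)
          fun x hx => ?_
        obtain ⟨h1, h2⟩ := hc.sq_sub_le hd hΩ hT hε hν hκ0 hκ1 hcone hδ hδr hs1 hs2 hN0 hN hz
          hx.2 hx.1
        rw [innerValue, indicator_of_mem h1, indicator_of_mem hx.1]
        exact h2
    _ ≤ ∫⁻ x, G (cubeIndex (ε * T) x) := setLIntegral_le_lintegral _ _
    _ = ENNReal.ofReal ((ε * T) ^ d) * ∑' l, G l := lintegral_comp_cubeIndex hs G
    _ = ENNReal.ofReal (((N + 1) * (ε * T)) ^ 2) * ∑' l, e l := by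
        simp only [hG]
        rw [ENNReal.tsum_mul_left, ENNReal.tsum_mul_left,
          Summable.tsum_finsetSum fun _ _ => ENNReal.summable]
        have htr : ∀ j ∈ Finset.range (N + 1),
            ∑' l : Fin d → ℤ, e (l + fun m => ⌊(j / N * z m) / (ε * T)⌋) = ∑' l, e l :=
          fun j _ => (Equiv.addRight (fun m => ⌊((j : ℝ) / N * z m) / (ε * T)⌋)).tsum_eq e
        rw [Finset.sum_congr rfl htr, Finset.sum_const, Finset.card_range, nsmul_eq_mul]
        have h1 : ((N : ℝ≥0∞) + 1) = ENNReal.ofReal (N + 1) := by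
          rw [ENNReal.ofReal_add (by positivity) zero_le_one]; simp
        push_cast
        rw [h1, ← mul_assoc, ← mul_assoc, ← mul_assoc, ← mul_assoc,
          ← ENNReal.ofReal_mul (by positivity), ← ENNReal.ofReal_mul (by positivity),
          ← ENNReal.ofReal_mul (by positivity)]
        congr 2
        field_simp
    _ ≤ ENNReal.ofReal (100 * δ ^ 2) * ∑' l, e l := by
        gcongr
        have : (0 : ℝ) ≤ (N + 1) * (ε * T) := by positivity
        nlinarith

end Translation

/-! ### The weak derivative as a limit of difference quotients -/

section WeakDerivative

variable {d : ℕ}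

theorem enorm_integral_mul_le {α : Type*} {_ : MeasurableSpace α} {μ : Measure α} {f g : α → ℝ}
    (hf : AEStronglyMeasurable f μ) (hg : AEStronglyMeasurable g μ) :
    ‖∫ x, f x * g x ∂μ‖ₑ ≤ eLpNorm f 2 μ * eLpNorm g 2 μ := by
  refine (enorm_integral_le_lintegral_enorm _).trans ?_
  rw [← eLpNorm_one_eq_lintegral_enorm]
  have h : eLpNorm (f • g) 1 μ ≤ eLpNorm f 2 μ * eLpNorm g 2 μ :=
    eLpNorm_smul_le_mul_eLpNorm hg hf
  exact h

theorem integrable_mul_of_memLp_two {α : Type*} {_ : MeasurableSpace α} {μ : Measure α}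
    {f g : α → ℝ} (hf : MemLp f 2 μ) (hg : MemLp g 2 μ) : Integrable (fun x => f x * g x) μ :=
  hf.integrable_mul hg

/-- The difference quotients of a test function converge to its derivative in `L²`. -/
theorem tendsto_eLpNorm_differenceQuotient {φ : Space d → ℝ} (hφ : ContDiff ℝ ∞ φ)
    (hc : HasCompactSupport φ) (a : Space d) {s : ℕ → ℝ} (hs : ∀ n, 0 < s n)
    (hs0 : Tendsto s atTop (𝓝 0)) :
    Tendsto (fun n => eLpNorm (fun x => (φ x - φ (x - s n • a)) / s n - fderiv ℝ φ x a) 2 volume)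
      atTop (𝓝 0) := by
  obtain ⟨L, hL⟩ := ContDiff.lipschitzWith_of_hasCompactSupport hc hφ (by simp)
  have hfd : Continuous fun x => fderiv ℝ φ x a :=
    (hφ.continuous_fderiv (by simp)).clm_apply continuous_const
  set K := Metric.cthickening ‖a‖ (tsupport φ)
  have hK : volume K ≠ ⊤ :=
    (hc.isCompact.isBounded.cthickening.measure_lt_top).ne
  have hKm : MeasurableSet K := Metric.isClosed_cthickening.measurableSet
  have hsub : tsupport φ ⊆ K := Metric.self_subset_cthickening _
  have hsq : Tendsto (fun n => ∫⁻ x, ‖(φ x - φ (x - s n • a)) / s n - fderiv ℝ φ x a‖ₑ ^ 2)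
      atTop (𝓝 0) := by
    have := tendsto_lintegral_filter_of_dominated_convergence (μ := volume) (l := atTop)
      (F := fun n x => ‖(φ x - φ (x - s n • a)) / s n - fderiv ℝ φ x a‖ₑ ^ 2) (f := fun _ => 0)
      (K.indicator fun _ => ENNReal.ofReal ((2 * (L * ‖a‖)) ^ 2))
      (Eventually.of_forall fun n => ?_) ?_ ?_ (Eventually.of_forall fun x => ?_)
    · simpa using this
    · have : Continuous fun x => (φ x - φ (x - s n • a)) / s n - fderiv ℝ φ x a := by
        have := hφ.continuous
        fun_prop
      exact this.measurable.enorm.pow_const 2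
    · filter_upwards [hs0.eventually_lt_const one_pos] with n hn
      refine Eventually.of_forall fun x => ?_
      by_cases hx : x ∈ K
      · rw [indicator_of_mem hx, enorm_sq_eq_ofReal]
        refine ENNReal.ofReal_le_ofReal (sq_le_sq' ?_ ?_) <;>
        · have h1 : |(φ x - φ (x - s n • a)) / s n| ≤ L * ‖a‖ := by
            rw [abs_div, abs_of_pos (hs n), div_le_iff₀ (hs n)]
            have := hL.dist_le_mul x (x - s n • a)
            rw [Real.dist_eq, dist_eq_norm, sub_sub_cancel, norm_smul, Real.norm_eq_abs,
              abs_of_pos (hs n)] at this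
            linarith
          have h2 : |fderiv ℝ φ x a| ≤ L * ‖a‖ :=
            ((fderiv ℝ φ x).le_opNorm a).trans
              (mul_le_mul_of_nonneg_right (norm_fderiv_le_of_lipschitz ℝ hL) (norm_nonneg a))
          have := abs_le.1 h1
          have := abs_le.1 h2
          linarith
      · have h1 : φ x = 0 := image_eq_zero_of_notMem_tsupport fun h => hx (hsub h)
        have h2 : φ (x - s n • a) = 0 := by
          refine image_eq_zero_of_notMem_tsupport fun h => hx ?_
          refine Metric.mem_cthickening_of_dist_le _ _ _ _ h ?_
          rw [dist_eq_norm, sub_sub_cancel, norm_smul, Real.norm_eq_abs, abs_of_pos (hs n)]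
          nlinarith [norm_nonneg a]
        have h3 : fderiv ℝ φ x = 0 := image_eq_zero_of_notMem_tsupport fun h =>
          hx (hsub (tsupport_fderiv_subset ℝ h))
        simp [h1, h2, h3]
    · rw [lintegral_indicator_const hKm]
      finiteness
    · have h1 := ((hφ.differentiable (by simp)) x).hasFDerivAt.hasLineDerivAt a
      have h2 : Tendsto (fun n => -s n) atTop (𝓝[≠] 0) := by
        refine tendsto_nhdsWithin_iff.2 ⟨by simpa using hs0.neg, Eventually.of_forall fun n => ?_⟩
        simpa using (hs n).ne'
      have h3 := (h1.tendsto_slope_zero.comp h2).sub_const (fderiv ℝ φ x a)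
      rw [sub_self] at h3
      have h4 := ENNReal.Tendsto.pow (n := 2) h3.enorm
      simp only [enorm_zero, ne_eq, OfNat.ofNat_ne_zero, not_false_eq_true, zero_pow] at h4
      refine h4.congr fun n => ?_
      congr 2
      simp only [Function.comp_apply, smul_eq_mul, neg_smul, ← sub_eq_add_neg]
      rw [inv_neg, neg_mul, div_eq_inv_mul]
      ring
  exact tendsto_eLpNorm_two_zero hsq

/-- Summation by parts in the limit: if, on every compact subset of `Ω`, the functions `q n` are
eventually the difference quotients of `v n` in the direction `a`, then the weak limit of `q n` is
the weak derivative of the weak limit of `v n`. -/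
theorem integral_mul_fderiv_eq_neg {v q : ℕ → Space d → ℝ} {w g : Space d → ℝ} {a : Space d}
    {s : ℕ → ℝ} (hs : ∀ n, 0 < s n) (hs0 : Tendsto s atTop (𝓝 0))
    (hv : ∀ n, MemLp (v n) 2 volume) {C : ℝ≥0} (hC : ∀ n, eLpNorm (v n) 2 volume ≤ C)
    (hvw : ∀ h, MemLp h 2 volume →
      Tendsto (fun n => ∫ x, v n x * h x) atTop (𝓝 (∫ x, w x * h x)))
    (hqg : ∀ h, MemLp h 2 volume →
      Tendsto (fun n => ∫ x, q n x * h x) atTop (𝓝 (∫ x, g x * h x)))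
    {Ω : Set (Space d)} (hq : ∀ K : Set (Space d), IsCompact K → K ⊆ Ω → ∀ᶠ n in atTop, ∀ x ∈ K,
      q n x = (v n (x + s n • a) - v n x) / s n)
    {φ : Space d → ℝ} (hφ : ContDiff ℝ ∞ φ) (hc : HasCompactSupport φ) (hφΩ : tsupport φ ⊆ Ω) :
    ∫ x, w x * fderiv ℝ φ x a = - ∫ x, g x * φ x := by
  have hφ2 : MemLp φ 2 volume := hφ.continuous.memLp_of_hasCompactSupport hc
  have hfd : Continuous fun x => fderiv ℝ φ x a :=
    (hφ.continuous_fderiv (by simp)).clm_apply continuous_const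
  have hfd2 : MemLp (fun x => fderiv ℝ φ x a) 2 volume :=
    hfd.memLp_of_hasCompactSupport (hc.fderiv_apply ℝ a)
  have htr : ∀ n, MemLp (fun x => φ (x - s n • a)) 2 volume := fun n =>
    hφ2.comp_measurePreserving (measurePreserving_sub_right volume (s n • a))
  have hquot : ∀ n, MemLp (fun x => (φ x - φ (x - s n • a)) / s n) 2 volume := fun n => by
    simpa only [div_eq_inv_mul, Pi.sub_apply] using (hφ2.sub (htr n)).const_mul (s n)⁻¹
  have hparts : ∀ᶠ n in atTop, ∫ x, q n x * φ x =
      - ∫ x, v n x * ((φ x - φ (x - s n • a)) / s n) := by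
    filter_upwards [hq _ hc.isCompact hφΩ] with n hn
    have h1 : ∀ x, q n x * φ x = (s n)⁻¹ * (v n (x + s n • a) * φ x - v n x * φ x) := by
      intro x
      by_cases hx : x ∈ tsupport φ
      · rw [hn x hx]; ring
      · simp [image_eq_zero_of_notMem_tsupport hx]
    have h2 : ∀ x, v n x * ((φ x - φ (x - s n • a)) / s n) =
        (s n)⁻¹ * (v n x * φ x - v n x * φ (x - s n • a)) := by intro x; ring
    have hvt : MemLp (fun x => v n (x + s n • a)) 2 volume :=
      (hv n).comp_measurePreserving (measurePreserving_add_right volume (s n • a))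
    have h3 : ∫ x, v n (x + s n • a) * φ x = ∫ x, v n x * φ (x - s n • a) := by
      rw [← integral_add_right_eq_self (μ := volume) (fun x => v n x * φ (x - s n • a)) (s n • a)]
      simp
    simp_rw [h1, h2]
    rw [integral_const_mul, integral_const_mul, integral_sub (integrable_mul_of_memLp_two hvt hφ2)
      (integrable_mul_of_memLp_two (hv n) hφ2), integral_sub
      (integrable_mul_of_memLp_two (hv n) hφ2) (integrable_mul_of_memLp_two (hv n) (htr n)), h3]
    ring
  have hlim1 : Tendsto (fun n => ∫ x, v n x * ((φ x - φ (x - s n • a)) / s n)) atTop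
      (𝓝 (∫ x, w x * fderiv ℝ φ x a)) := by
    have herr : Tendsto (fun n => ∫ x, v n x * ((φ x - φ (x - s n • a)) / s n -
        fderiv ℝ φ x a)) atTop (𝓝 0) := by
      rw [tendsto_zero_iff_enorm_tendsto_zero]
      have hz := ENNReal.Tendsto.const_mul (a := (C : ℝ≥0∞))
        (tendsto_eLpNorm_differenceQuotient hφ hc a hs hs0) (Or.inr ENNReal.coe_ne_top)
      rw [mul_zero] at hz
      refine tendsto_of_tendsto_of_tendsto_of_le_of_le tendsto_const_nhds hz
        (fun n => zero_le) fun n => ?_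
      refine (enorm_integral_mul_le (hv n).1 ((hquot n).sub hfd2).1).trans ?_
      exact mul_le_mul_left (hC n) _
    have := herr.add (hvw _ hfd2)
    rw [zero_add] at this
    refine this.congr fun n => ?_
    have hint : Integrable fun x => v n x * ((φ x - φ (x - s n • a)) / s n - fderiv ℝ φ x a) :=
      integrable_mul_of_memLp_two (hv n) ((hquot n).sub hfd2)
    rw [← integral_add hint (integrable_mul_of_memLp_two (hv n) hfd2)]
    congr 1
    funext x
    ring
  have hlim2 := (hqg φ hφ2).congr' hparts
  have := tendsto_nhds_unique hlim2 hlim1.neg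
  rw [this, neg_neg]

end WeakDerivative

/-! ### Compactness of bounded cell values -/

section Compactness

variable {d : ℕ}

/-- On small scales, a compact part of `Ω` and its translates by at most one cell consist of points
of inner cells. -/
theorem exists_innerSet_of_isCompact {T : ℕ} {Ω : Set (Space d)} (hΩ : IsOpen Ω) (hT : 1 ≤ T)
    {K : Set (Space d)} (hK : IsCompact K) (hKΩ : K ⊆ Ω) :
    ∃ η : ℝ, 0 < η ∧ ∀ ε : ℝ, 0 < ε → ε < η → ∀ x ∈ K, ∀ b : Space d, ‖b‖ ≤ ε * T →
      x + b ∈ innerSet T Ω ε := by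
  obtain ⟨ρ, hρ, hsub⟩ := hK.exists_thickening_subset_open hΩ hKΩ
  have hT' : (0 : ℝ) < T := by exact_mod_cast hT
  have hd0 : 0 ≤ Real.sqrt d := Real.sqrt_nonneg _
  have hden : 0 < (3 * Real.sqrt d + 1) * T := by positivity
  refine ⟨ρ / ((3 * Real.sqrt d + 1) * T), by positivity, fun ε hε hlt x hx b hb => ?_⟩
  rw [lt_div_iff₀ hden] at hlt
  refine mem_innerSet_of_ball_subset hΩ hε hT (R := ρ - ε * T) (by nlinarith) ?_
  intro y hy
  refine hsub (Metric.mem_thickening_iff.2 ⟨x, hx, ?_⟩)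
  have h1 := dist_triangle y (x + b) x
  rw [dist_eq_norm (x + b), add_sub_cancel_left] at h1
  have := Metric.mem_ball.1 hy
  linarith

/-- Weak convergence of the cell values implies their strong convergence on bounded sets, up to the
boundary of the domain. -/
theorem tendsto_lintegral_innerSet_inter {T : ℕ} {Ω : Set (Space d)} (hd : 1 ≤ d)
    (hΩ : IsOpen Ω) (hL : HasLipschitzBoundary Ω) (hT : 1 ≤ T) {ε : ℕ → ℝ} (hε : ∀ n, 0 < ε n)
    (hε0 : Tendsto ε atTop (𝓝 0)) {f : ℕ → (Fin d → ℤ) → ℝ} {e : ℕ → (Fin d → ℤ) → ℝ≥0∞}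
    (hc : ∀ n, CellControl T Ω (ε n) (f n) (e n)) {C : ℝ≥0} (he : ∀ n, ∑' l, e n l ≤ C)
    (hv : ∀ n, MemLp (innerValue T Ω (ε n) (f n)) 2 volume) {C' : ℝ≥0}
    (hC' : ∀ n, eLpNorm (innerValue T Ω (ε n) (f n)) 2 volume ≤ C')
    {w : Space d → ℝ} (hwm : Measurable w) (hw : MemLp w 2 volume)
    (hlim : ∀ g, MemLp g 2 volume →
      Tendsto (fun n => ∫ x, innerValue T Ω (ε n) (f n) x * g x) atTop (𝓝 (∫ x, w x * g x)))
    {B : Set (Space d)} (hB : Bornology.IsBounded B) :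
    Tendsto (fun n => ∫⁻ x in innerSet T Ω (ε n) ∩ B,
      ‖f n (cubeIndex (ε n * T) x) - w x‖ₑ ^ 2) atTop (𝓝 0) := by
  have hT' : (0 : ℝ) < T := by exact_mod_cast hT
  have hs0 : Tendsto (fun n => ε n * T) atTop (𝓝 0) := by simpa using hε0.mul_const (T : ℝ)
  have hloc : ∀ x₀ ∈ closure Ω, ∃ r : ℝ, 0 < r ∧
      Tendsto (fun n => ∫⁻ x in innerSet T Ω (ε n) ∩ Metric.ball x₀ (r / 2),
        ‖f n (cubeIndex (ε n * T) x) - w x‖ₑ ^ 2) atTop (𝓝 0) := by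
    intro x₀ hx₀
    obtain ⟨ν, r, κ, hν, hr, hκ0, hκ1, hcone⟩ := hL.exists_cone hΩ hx₀
    refine ⟨r, hr, ?_⟩
    have := tendsto_lintegral_of_translations
      (fun n => measurable_innerValue T Ω (ε n) (f n)) hv hC' hwm hw hlim
      (A := fun n => innerSet T Ω (ε n) ∩ Metric.ball x₀ (r / 2)) (B := Metric.ball x₀ (r / 2))
      (fun n => inter_subset_right) measure_ball_lt_top.ne ?_
    · refine this.congr fun n => ?_
      refine setLIntegral_congr_fun ((measurableSet_innerSet _ _ _).inter measurableSet_ball)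
        fun x hx => ?_
      rw [innerValue, indicator_of_mem hx.1]
    · intro η hη
      obtain ⟨δ, hδ, hδr, hδη, hδC⟩ : ∃ δ : ℝ, 0 < δ ∧ δ ≤ r ∧ 2 * δ ≤ η ∧
          100 * δ ^ 2 * C ≤ η := by
        refine ⟨min (min r 1) (min (η / 2) (η / (100 * (C + 1)))), by positivity,
          (min_le_left _ _).trans (min_le_left _ _), ?_, ?_⟩
        · have := (min_le_right (min r 1) (min (η / 2) (η / (100 * ((C : ℝ) + 1))))).trans
            (min_le_left _ _)
          linarith
        · set δ := min (min r 1) (min (η / 2) (η / (100 * ((C : ℝ) + 1)))) with hδ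
          have h0 : 0 < δ := by positivity
          have h1 : δ ≤ 1 := (min_le_left _ _).trans (min_le_right _ _)
          have h2 : δ ≤ η / (100 * ((C : ℝ) + 1)) := (min_le_right _ _).trans (min_le_right _ _)
          rw [le_div_iff₀ (by positivity)] at h2
          have hC0 : (0 : ℝ) ≤ C := C.2
          nlinarith [mul_nonneg hC0 (mul_nonneg h0.le (sub_nonneg.2 h1))]
      refine ⟨Metric.ball (δ • ν) (δ * κ / 2), measurableSet_ball,
        (Metric.measure_ball_pos volume _ (by positivity)).ne', fun z hz => ?_, ?_⟩
      · rw [Metric.mem_ball, dist_eq_norm] at hz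
        have h2 := norm_add_le (z - δ • ν) (δ • ν)
        rw [sub_add_cancel, norm_smul, Real.norm_eq_abs, abs_of_pos hδ] at h2
        rw [mem_ball_zero_iff]
        nlinarith
      · have e1 : ∀ᶠ n in atTop, 3 * Real.sqrt d * (ε n * T) < r / 2 :=
          (hs0.const_mul (3 * Real.sqrt d)).eventually_lt_const (by rw [mul_zero]; positivity)
        have e2 : ∀ᶠ n in atTop, 2 * Real.sqrt d * (ε n * T) < δ * κ / 2 :=
          (hs0.const_mul (2 * Real.sqrt d)).eventually_lt_const (by rw [mul_zero]; positivity)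
        have e3 : ∀ᶠ n in atTop, ε n * T < δ := hs0.eventually_lt_const hδ
        filter_upwards [e1, e2, e3] with n h1 h2 h3 z hz
        refine ((hc n).lintegral_translate_sub_le hd hΩ hT (hε n) hν hκ0 hκ1 hcone hδ hδr h1 h2
          h3.le hz).trans ?_
        refine (mul_le_mul_right (he n) _).trans ?_
        rw [← ENNReal.ofReal_coe_nnreal, ← ENNReal.ofReal_mul (by positivity)]
        exact ENNReal.ofReal_le_ofReal hδC
  -- finitely many of these neighbourhoods cover the part of the closure that meets `B`
  have hcomp : IsCompact (closure Ω ∩ closure B) :=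
    hB.isCompact_closure.inter_left isClosed_closure
  have hall := hcomp.induction_on (p := fun S => Tendsto (fun n => ∫⁻ x in innerSet T Ω (ε n) ∩ S,
      ‖f n (cubeIndex (ε n * T) x) - w x‖ₑ ^ 2) atTop (𝓝 0)) (by simp) (fun S S' hSS' h => ?_)
      (fun S S' h h' => ?_) (fun x₀ hx₀ => ?_)
  · refine tendsto_of_tendsto_of_tendsto_of_le_of_le tendsto_const_nhds hall
      (fun n => zero_le) fun n => lintegral_mono_set fun x hx => ⟨hx.1, subset_closure ?_,
        subset_closure hx.2⟩
    exact innerSet_subset hd (hε n) hT hx.1 rfl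
  · exact tendsto_of_tendsto_of_tendsto_of_le_of_le tendsto_const_nhds h (fun n => zero_le)
      fun n => lintegral_mono_set (inter_subset_inter_right _ hSS')
  · have := h.add h'
    rw [add_zero] at this
    refine tendsto_of_tendsto_of_tendsto_of_le_of_le tendsto_const_nhds this (fun n => zero_le)
      fun n => ?_
    simp only [inter_union_distrib_left]
    exact lintegral_union_le _ _ _
  · obtain ⟨r, hr, h⟩ := hloc x₀ hx₀.1
    exact ⟨_, mem_nhdsWithin_of_mem_nhds (Metric.ball_mem_nhds x₀ (by positivity)), h⟩

/-- The compactness theorem for cell values. Bounded cell values whose difference quotients are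
controlled by a bounded energy converge strongly, up to a subsequence, on the whole union of the
inner cells; the limit lies in `H¹`. -/
theorem exists_tendsto_of_cellControl {T : ℕ} {Ω : Set (Space d)} (hd : 1 ≤ d)
    (hΩ : IsOpen Ω) (hL : HasLipschitzBoundary Ω) (hT : 1 ≤ T) {ε : ℕ → ℝ} (hε : ∀ n, 0 < ε n)
    (hε0 : Tendsto ε atTop (𝓝 0)) {f : ℕ → (Fin d → ℤ) → ℝ} {e : ℕ → (Fin d → ℤ) → ℝ≥0∞}
    (hc : ∀ n, CellControl T Ω (ε n) (f n) (e n)) {C : ℝ≥0} (he : ∀ n, ∑' l, e n l ≤ C)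
    (hf : ∀ n, ∑' l : innerIndices T Ω (ε n), ENNReal.ofReal ((ε n * T) ^ d * f n l ^ 2) ≤ C) :
    ∃ φ : ℕ → ℕ, StrictMono φ ∧ ∃ w : Space d → ℝ, Measurable w ∧ MemH1 Ω w ∧
      ∀ B : Set (Space d), Bornology.IsBounded B →
        Tendsto (fun n => ∫⁻ x in innerSet T Ω (ε (φ n)) ∩ B,
          ‖f (φ n) (cubeIndex (ε (φ n) * T) x) - w x‖ₑ ^ 2) atTop (𝓝 0) := by
  classical
  have hT' : (0 : ℝ) < T := by exact_mod_cast hT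
  have hs : ∀ n, 0 < ε n * T := fun n => mul_pos (hε n) hT'
  have hs0 : Tendsto (fun n => ε n * T) atTop (𝓝 0) := by simpa using hε0.mul_const (T : ℝ)
  -- functions that are constant on the cells
  have hstepL2 : ∀ (n : ℕ) (h : (Fin d → ℤ) → ℝ),
      ∑' l, ENNReal.ofReal ((ε n * T) ^ d * h l ^ 2) ≤ C →
      MemLp (fun x => h (cubeIndex (ε n * T) x)) 2 volume ∧
        eLpNorm (fun x => h (cubeIndex (ε n * T) x)) 2 volume ≤ (C + 1 : ℝ≥0) := by
    intro n h hh
    have h1 : eLpNorm (fun x => h (cubeIndex (ε n * T) x)) 2 volume ^ 2 ≤ C := by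
      rw [eLpNorm_two_sq, lintegral_comp_cubeIndex (hs n) fun l => ‖h l‖ₑ ^ 2,
        ← ENNReal.tsum_mul_left]
      refine le_trans (le_of_eq (tsum_congr fun l => ?_)) hh
      rw [enorm_sq_eq_ofReal, ENNReal.ofReal_mul (pow_pos (hs n) d).le]
    have h2 : eLpNorm (fun x => h (cubeIndex (ε n * T) x)) 2 volume ≤ (C + 1 : ℝ≥0) := by
      refine (ENNReal.pow_le_pow_left_iff two_ne_zero).1 (h1.trans ?_)
      exact_mod_cast (by nlinarith [C.2] : (C : ℝ≥0) ≤ (C + 1) ^ 2)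
    exact ⟨⟨((measurable_of_countable h).comp (measurable_cubeIndex _)).aestronglyMeasurable,
      h2.trans_lt ENNReal.coe_lt_top⟩, h2⟩
  -- the cell values and their difference quotients, cut off outside of the inner cells
  set h₀ : ℕ → (Fin d → ℤ) → ℝ := fun n => (innerIndices T Ω (ε n)).indicator (f n) with hh₀
  set h₁ : Fin d → ℕ → (Fin d → ℤ) → ℝ := fun i n l =>
    if l ∈ innerIndices T Ω (ε n) ∧ l + Pi.single i 1 ∈ innerIndices T Ω (ε n) then
      (f n (l + Pi.single i 1) - f n l) / (ε n * T) else 0 with hh₁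
  have hval : ∀ n, innerValue T Ω (ε n) (f n) = fun x => h₀ n (cubeIndex (ε n * T) x) :=
    fun n => rfl
  have hb₀ : ∀ n, ∑' l, ENNReal.ofReal ((ε n * T) ^ d * h₀ n l ^ 2) ≤ C := by
    intro n
    refine le_trans (le_of_eq ?_) (hf n)
    rw [tsum_subtype (innerIndices T Ω (ε n))
      fun l => ENNReal.ofReal ((ε n * T) ^ d * f n l ^ 2)]
    refine tsum_congr fun l => ?_
    by_cases hl : l ∈ innerIndices T Ω (ε n) <;> simp [hh₀, hl]
  have hb₁ : ∀ i n, ∑' l, ENNReal.ofReal ((ε n * T) ^ d * h₁ i n l ^ 2) ≤ C := by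
    intro i n
    refine (ENNReal.tsum_le_tsum fun l => ?_).trans (he n)
    simp only [hh₁]
    split_ifs with hl
    · have := (hc n).le_of_adjacent (hs n) (l := l) hl.2 fun m => by
        by_cases hm : m = i
        · subst hm; simp
        · simp [hm]
      rwa [div_pow, ← neg_sub, neg_sq, ← div_pow] at this
    · simp
  set F : Option (Fin d) → ℕ → Space d → ℝ := fun o n x =>
    o.elim (h₀ n (cubeIndex (ε n * T) x)) fun i => h₁ i n (cubeIndex (ε n * T) x)
  have hF : ∀ o n, MemLp (F o n) 2 volume ∧ eLpNorm (F o n) 2 volume ≤ (C + 1 : ℝ≥0) := by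
    intro o n
    cases o with
    | none => exact hstepL2 n _ (hb₀ n)
    | some i => exact hstepL2 n _ (hb₁ i n)
  obtain ⟨φ, hφ, hlim⟩ := exists_common_weakly_convergent_subseq (fun o n => (hF o n).1)
    fun o n => (hF o n).2
  obtain ⟨w, hwm, hw, hwlim⟩ := hlim none
  choose g hgm hg hglim using fun i => hlim (some i)
  have hεφ : Tendsto (fun n => ε (φ n)) atTop (𝓝 0) := hε0.comp hφ.tendsto_atTop
  have hsφ : Tendsto (fun n => ε (φ n) * T) atTop (𝓝 0) := hs0.comp hφ.tendsto_atTop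
  refine ⟨φ, hφ, w, hwm.measurable, ⟨hw.restrict Ω,
    fun x => ∑ i, g i x • EuclideanSpace.single i (1 : ℝ), ?_, ?_⟩, fun B hB => ?_⟩
  · refine memLp_finsetSum _ fun i _ => ?_
    exact (ContinuousLinearMap.toSpanSingleton ℝ (EuclideanSpace.single i (1 : ℝ))).comp_memLp'
      ((hg i).restrict Ω)
  · intro ψ hψ hψc hψΩ v
    have hpart : ∀ i, ∫ x, w x * fderiv ℝ ψ x (EuclideanSpace.single i 1) =
        - ∫ x, g i x * ψ x := by
      intro i
      refine integral_mul_fderiv_eq_neg (fun n => hs (φ n)) hsφ (fun n => (hF none (φ n)).1)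
        (fun n => (hF none (φ n)).2) hwlim (hglim i) (fun K hK hKΩ => ?_) hψ hψc hψΩ
      obtain ⟨η, hη, hin⟩ := exists_innerSet_of_isCompact hΩ hT hK hKΩ
      filter_upwards [hεφ.eventually_lt_const hη] with n hn x hx
      have h1 := hin _ (hε (φ n)) hn x hx 0 (by simpa using (hs (φ n)).le)
      have h2 := hin _ (hε (φ n)) hn x hx ((ε (φ n) * T) • EuclideanSpace.single i (1 : ℝ))
        (by rw [norm_smul, PiLp.norm_single, Real.norm_eq_abs, abs_of_pos (hs _)]; simp)
      rw [add_zero] at h1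
      have h3 : cubeIndex (ε (φ n) * T)
          (x + (ε (φ n) * T) • EuclideanSpace.single i (1 : ℝ)) =
          cubeIndex (ε (φ n) * T) x + Pi.single i 1 := by
        funext m
        have hne := (hs (φ n)).ne'
        by_cases hm : m = i
        · subst hm
          simp [cubeIndex, add_div, div_self hne]
        · simp [cubeIndex, hm]
      have h2' : cubeIndex (ε (φ n) * T) x + Pi.single i 1 ∈ innerIndices T Ω (ε (φ n)) := by
        rw [← h3]; exact h2
      have h1' : cubeIndex (ε (φ n) * T) x ∈ innerIndices T Ω (ε (φ n)) := h1
      simp only [F, Option.elim, hh₀, hh₁]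
      rw [h3, if_pos ⟨h1', h2'⟩, indicator_of_mem h1', indicator_of_mem h2']
    have hψ2 : MemLp ψ 2 volume := hψ.continuous.memLp_of_hasCompactSupport hψc
    have hfd2 : ∀ a, MemLp (fun x => fderiv ℝ ψ x a) 2 volume := fun a =>
      ((hψ.continuous_fderiv (by simp)).clm_apply continuous_const).memLp_of_hasCompactSupport
        (hψc.fderiv_apply ℝ a)
    have hv : v = ∑ i, v i • EuclideanSpace.single i (1 : ℝ) := by
      have := ((EuclideanSpace.basisFun (Fin d) ℝ).sum_repr v).symm
      simpa using this
    rw [setIntegral_eq_integral_of_forall_compl_eq_zero fun x hx => ?_,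
      setIntegral_eq_integral_of_forall_compl_eq_zero fun x hx => ?_]
    · have hl : ∀ x, w x * fderiv ℝ ψ x v =
          ∑ i, v i * (w x * fderiv ℝ ψ x (EuclideanSpace.single i 1)) := by
        intro x
        conv_lhs => rw [hv]
        rw [map_sum, Finset.mul_sum]
        refine Finset.sum_congr rfl fun i _ => ?_
        rw [map_smul, smul_eq_mul]; ring
      have hr : ∀ x, inner ℝ (∑ i, g i x • EuclideanSpace.single i (1 : ℝ)) v * ψ x =
          ∑ i, v i * (g i x * ψ x) := by
        intro x
        rw [sum_inner, Finset.sum_mul]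
        refine Finset.sum_congr rfl fun i _ => ?_
        rw [real_inner_smul_left, EuclideanSpace.inner_single_left]
        simp; ring
      simp_rw [hl, hr]
      rw [integral_finsetSum _ fun i _ => (integrable_mul_of_memLp_two hw (hfd2 _)).const_mul _,
        integral_finsetSum _ fun i _ => (integrable_mul_of_memLp_two (hg i) hψ2).const_mul _,
        ← Finset.sum_neg_distrib]
      refine Finset.sum_congr rfl fun i _ => ?_
      rw [integral_const_mul, integral_const_mul, hpart, mul_neg]
    · rw [image_eq_zero_of_notMem_tsupport fun h => hx (hψΩ h), mul_zero]
    · have : fderiv ℝ ψ x = 0 := image_eq_zero_of_notMem_tsupport fun h =>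
        hx (hψΩ (tsupport_fderiv_subset ℝ h))
      rw [this]; simp
  · exact tendsto_lintegral_innerSet_inter hd hΩ hL hT (fun n => hε (φ n)) hεφ
      (fun n => hc (φ n)) (fun n => he (φ n)) (fun n => (hF none (φ n)).1)
      (fun n => (hF none (φ n)).2) hwm.measurable hw hwlim hB

end Compactness

/-! ### Cell averages and convergence on the perforated domain -/

section Cells

variable {d k : ℕ}

/-- An average is at most as far from `c` as one of the averaged values. -/
theorem exists_abs_average_sub_le {ι : Type*} {A : Finset ι} (hA : A.Nonempty) (u : ι → ℝ)
    (c : ℝ) : ∃ i ∈ A, |(A.card : ℝ)⁻¹ * ∑ i ∈ A, u i - c| ≤ |u i - c| := by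
  by_contra! h
  have hcard : (0 : ℝ) < A.card := by exact_mod_cast hA.card_pos
  set t := |(A.card : ℝ)⁻¹ * ∑ i ∈ A, u i - c| with ht
  have h1 : (A.card : ℝ)⁻¹ * ∑ i ∈ A, u i - c = (A.card : ℝ)⁻¹ * ∑ i ∈ A, (u i - c) := by
    rw [Finset.sum_sub_distrib, Finset.sum_const, nsmul_eq_mul, mul_sub, inv_mul_cancel_left₀
      hcard.ne']
  have h2 : ∑ i ∈ A, |u i - c| < A.card * t := by
    refine (Finset.sum_lt_sum_of_nonempty hA h).trans_eq ?_
    rw [Finset.sum_const, nsmul_eq_mul]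
  have h3 : t ≤ (A.card : ℝ)⁻¹ * ∑ i ∈ A, |u i - c| := by
    rw [ht, h1, abs_mul, abs_of_pos (inv_pos.2 hcard)]
    gcongr
    exact Finset.abs_sum_le_sum_abs _ _
  have h4 : (A.card : ℝ)⁻¹ * ∑ i ∈ A, |u i - c| < t := by
    rwa [inv_mul_lt_iff₀ hcard]
  exact absurd h3 (not_le.2 h4)

theorem mem_cellNodes {S : ℕ} {X : Set (Node d k)} {l : Fin d → ℤ} {i : Node d k} :
    i ∈ cellNodes S X l ↔ (∀ m, (S : ℤ) * l m ≤ i.1 m ∧ i.1 m < S * (l m + 1)) ∧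
      (∀ n, 0 ≤ i.2 n ∧ i.2 n < S) ∧ i ∈ X := by
  simp [cellNodes, Finset.mem_product, Fintype.mem_piFinset, and_assoc]

theorem IsThinNetwork.cellNodes_nonempty {T : ℕ} {X : Set (Node d k)}
    {E : Set (Node d k × Node d k)} {a : Node d k → Node d k → ℝ} (hX : IsThinNetwork T X E a)
    (hT : 1 ≤ T) {S : ℕ} (hS : 1 ≤ S) (hTS : T ∣ S) (l : Fin d → ℤ) :
    (cellNodes S X l).Nonempty := by
  obtain ⟨c, rfl⟩ := hTS
  have hc : 0 < c := Nat.pos_of_mul_pos_left hS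
  obtain ⟨i, hi⟩ := hX.nonempty
  refine ⟨nodeTranslate T (fun m => c * l m - i.1 m / T) i, mem_cellNodes.2
    ⟨fun m => ?_, fun n => ?_, (hX.nodeTranslate_mem_iff _ _).2 hi⟩⟩
  · have hT' : (0 : ℤ) < T := by exact_mod_cast hT
    have h1 := Int.emod_add_mul_ediv (i.1 m) T
    have h2 := Int.emod_nonneg (i.1 m) hT'.ne'
    have h3 := Int.emod_lt_of_pos (i.1 m) hT'
    have h4 : (nodeTranslate T (fun m => c * l m - i.1 m / T) i).1 m =
        T * c * l m + i.1 m % T := by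
      simp only [nodeTranslate, Pi.add_apply]
      linarith [mul_sub (T : ℤ) (c * l m) (i.1 m / T), mul_assoc (T : ℤ) c (l m)]
    have h5 : (1 : ℤ) ≤ c := by exact_mod_cast hc
    rw [h4]
    push_cast
    constructor
    · linarith
    · nlinarith
  · refine ⟨(hX.bounded i hi n).1, (hX.bounded i hi n).2.trans_le ?_⟩
    exact_mod_cast Nat.le_mul_of_pos_right T hc

/-- The convergence statement for a network with period `S`. The sets `Y n` carry the energies;
they contain every node that lies close to a point deep inside `Ω`, in the sense that it can occur
on a path of range `ρ` between two neighbouring cells. -/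
theorem IsThinNetwork.exists_perforatedConvergence {T : ℕ} {X : Set (Node d k)}
    {E : Set (Node d k × Node d k)} {a : Node d k → Node d k → ℝ} (hX : IsThinNetwork T X E a)
    (hd : 1 ≤ d) (hT : 1 ≤ T) {ρ : ℕ}
    (hρ : ∀ n : ℕ, ∃ C : ℝ≥0, ∀ i ∈ X, ∀ j ∈ X, ∑ m, |i.1 m - j.1 m| ≤ n →
      ∀ (ε : ℝ) (u : Node d k → ℝ), 0 < ε →
        pairEnergy ε u i j ≤ C * energy (X ∩ boxAround ρ i j) a ε u)
    {S : ℕ} (hS : 1 ≤ S) (hTS : T ∣ S) {Ω : Set (Space d)} (hΩ : IsOpen Ω)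
    (hL : HasLipschitzBoundary Ω) {ε : ℕ → ℝ} (hε : ∀ n, 0 < ε n)
    (hε0 : Tendsto ε atTop (𝓝 0)) {u : ℕ → Node d k → ℝ} {Y : ℕ → Set (Node d k)}
    (hY : ∀ n (y : Space d), Metric.ball y (2 * Real.sqrt d * (ε n * S)) ⊆ Ω → ∀ q ∈ X,
      (∀ m, |ε n * q.1 m - y m| ≤ 5 / 4 * (ε n * S) + ε n * ρ) → q ∈ Y n)
    {C : ℝ≥0} (hC : ∀ n, discreteNormSq S X Ω (ε n) (u n) + energy (Y n) a (ε n) (u n) ≤ C) :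
    ∃ φ : ℕ → ℕ, StrictMono φ ∧ ∃ w : Space d → ℝ, MemH1 Ω w ∧
      PerforatedConvergence S X Ω (ε ∘ φ) (u ∘ φ) w := by
  have hS' : (1 : ℝ) ≤ S := by exact_mod_cast hS
  have hs : ∀ n, 0 < ε n * S := fun n => mul_pos (hε n) (by linarith)
  have hTS' : T ≤ S := Nat.le_of_dvd hS hTS
  -- nodes of two neighbouring cells differ by at most `3 S` in each coordinate, and the boxes
  -- around them stay within distance `4 S + ρ` of the corner of either cell
  obtain ⟨C₁, hC₁⟩ := hρ (d * (3 * S))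
  obtain ⟨N, hN⟩ := tsum_energy_window_le (d := d) (k := k) (4 * S + ρ) hS
  set e : ℕ → (Fin d → ℤ) → ℝ≥0∞ := fun n l => (S : ℝ≥0∞) ^ d *
    (C₁ * energy (Y n ∩ window k (4 * S + ρ) S l) a (ε n) (u n)) with he
  set f : ℕ → (Fin d → ℤ) → ℝ := fun n => cellAverage S X (u n) with hf
  have hS1 : (1 : ℝ≥0∞) ≤ (S : ℝ≥0∞) ^ d := one_le_pow₀ (by exact_mod_cast hS)
  -- the Poincaré inequality for the nodes of neighbouring cells, localized to `Y n`
  have hpair : ∀ n (l l' : Fin d → ℤ) (y : Space d),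
      Metric.ball y (2 * Real.sqrt d * (ε n * S)) ⊆ Ω →
      (∀ m, y m - 5 / 4 * (ε n * S) ≤ ε n * S * l m ∧
        ε n * S * (l m + 1) ≤ y m + 5 / 4 * (ε n * S)) →
      (∀ m, y m - 5 / 4 * (ε n * S) ≤ ε n * S * l' m ∧
        ε n * S * (l' m + 1) ≤ y m + 5 / 4 * (ε n * S)) →
      ∀ i ∈ cellNodes S X l, ∀ j ∈ cellNodes S X l', pairEnergy (ε n) (u n) i j ≤
        C₁ * energy (Y n ∩ window k (4 * S + ρ) S l) a (ε n) (u n) := by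
    intro n l l' y hy hl hl' i hi j hj
    rw [mem_cellNodes] at hi hj
    have hpos : ∀ (c : Fin d → ℤ) (p : Node d k), (∀ m, y m - 5 / 4 * (ε n * S) ≤ ε n * S * c m ∧
        ε n * S * (c m + 1) ≤ y m + 5 / 4 * (ε n * S)) →
        (∀ m, (S : ℤ) * c m ≤ p.1 m ∧ p.1 m < S * (c m + 1)) →
        ∀ m, y m - 5 / 4 * (ε n * S) ≤ ε n * p.1 m ∧ ε n * p.1 m ≤ y m + 5 / 4 * (ε n * S) := by
      intro c p hc hp m
      have h1 : ((S : ℝ) * c m) ≤ p.1 m := by exact_mod_cast (hp m).1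
      have h2 : (p.1 m : ℝ) ≤ S * (c m + 1) := by exact_mod_cast (hp m).2.le
      have h3 := mul_le_mul_of_nonneg_left h1 (hε n).le
      have h4 := mul_le_mul_of_nonneg_left h2 (hε n).le
      have := hc m
      constructor <;> nlinarith
    have hi' := hpos l i hl hi.1
    have hj' := hpos l' j hl' hj.1
    have hdist : ∀ m, |i.1 m - j.1 m| ≤ 3 * S := by
      intro m
      have h1 : |(i.1 m : ℝ) - j.1 m| ≤ 3 * S := by
        have h2 : |ε n * ((i.1 m : ℝ) - j.1 m)| ≤ ε n * (3 * S) := by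
          have := hi' m
          have := hj' m
          have := hs n
          rw [abs_le]; constructor <;> nlinarith
        rw [abs_mul, abs_of_pos (hε n)] at h2
        exact le_of_mul_le_mul_left h2 (hε n)
      exact_mod_cast h1
    refine (hC₁ i hi.2.2 j hj.2.2 ?_ (ε n) (u n) (hε n)).trans ?_
    · refine (Finset.sum_le_sum fun m _ => hdist m).trans ?_
      simp
    · refine mul_le_mul_right (energy_mono ?_ a _ _) _
      rintro q ⟨hqX, hq⟩
      refine ⟨hY n y hy q hqX fun m => ?_, fun m => ?_⟩
      · obtain ⟨h1, h2⟩ := hq m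
        have h1' : min (i.1 m : ℝ) (j.1 m) - ρ ≤ q.1 m := by exact_mod_cast h1
        have h2' : (q.1 m : ℝ) ≤ max (i.1 m : ℝ) (j.1 m) + ρ := by exact_mod_cast h2
        have h3 := hi' m
        have h4 := hj' m
        have h5 := hε n
        rw [abs_le]
        constructor
        · rcases min_choice (i.1 m : ℝ) (j.1 m) with h | h <;> rw [h] at h1' <;> nlinarith
        · rcases max_choice (i.1 m : ℝ) (j.1 m) with h | h <;> rw [h] at h2' <;> nlinarith
      · have h1 := hq m
        have h2 := abs_le.1 (hdist m)
        have h3 := hi.1 m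
        rw [abs_le]
        push_cast
        rcases min_choice (i.1 m) (j.1 m) with h | h <;>
          rcases max_choice (i.1 m) (j.1 m) with h' | h' <;> rw [h, h'] at h1 <;>
          constructor <;> nlinarith
  have hctrl : ∀ n, CellControl S Ω (ε n) (f n) (e n) := by
    intro n l l' y hy hl hl'
    obtain ⟨i, hi, h1⟩ := exists_abs_average_sub_le (hX.cellNodes_nonempty hT hS hTS l) (u n)
      (f n l')
    obtain ⟨j, hj, h2⟩ := exists_abs_average_sub_le (hX.cellNodes_nonempty hT hS hTS l') (u n)
      (u n i)
    have h3 : |f n l - f n l'| ≤ |u n i - u n j| := by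
      refine h1.trans ?_
      rw [abs_sub_comm, abs_sub_comm (u n i)]
      exact h2
    refine le_trans ?_ (mul_le_mul_right (hpair n l l' y hy hl hl' i hi j hj) _)
    unfold pairEnergy
    rw [← ENNReal.ofReal_natCast, ← ENNReal.ofReal_pow (by positivity),
      ← ENNReal.ofReal_mul (by positivity)]
    refine ENNReal.ofReal_le_ofReal ?_
    rw [mul_pow, mul_comm (ε n ^ d), mul_assoc]
    have hle : ((f n l - f n l') / (ε n * S)) ^ 2 ≤ ((u n i - u n j) / ε n) ^ 2 := by
      rw [sq_le_sq, abs_div, abs_div, abs_of_pos (hs n), abs_of_pos (hε n)]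
      exact div_le_div₀ (abs_nonneg _) h3 (hε n) (by nlinarith [hε n])
    have := hε n
    gcongr
  -- the oscillation inside of an inner cell
  have hosc : ∀ n, ∀ l ∈ innerIndices S Ω (ε n), ∀ i ∈ cellNodes S X l,
      ‖u n i - f n l‖ₑ ^ 2 ≤ ENNReal.ofReal (ε n ^ 2 / ε n ^ d) * e n l := by
    intro n l hl i hi
    obtain ⟨j, hj, h2⟩ := exists_abs_average_sub_le (hX.cellNodes_nonempty hT hS hTS l) (u n)
      (u n i)
    have hcell : ∀ m, latticePoint (ε n * S) l m - 5 / 4 * (ε n * S) ≤ ε n * S * l m ∧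
        ε n * S * (l m + 1) ≤ latticePoint (ε n * S) l m + 5 / 4 * (ε n * S) := by
      intro m
      have := hs n
      simp only [latticePoint]
      constructor <;> nlinarith
    have h3 := hpair n l l _ (ball_subset_of_mem_innerIndices hl) hcell hcell i hi j hj
    have h4 : pairEnergy (ε n) (u n) i j ≤ e n l :=
      h3.trans (le_mul_of_one_le_left zero_le hS1)
    refine le_trans ?_ (mul_le_mul_right h4 _)
    unfold pairEnergy
    have := hε n
    rw [enorm_sq_eq_ofReal, ← ENNReal.ofReal_mul (by positivity)]
    refine ENNReal.ofReal_le_ofReal ?_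
    have h5 : (u n i - f n l) ^ 2 ≤ (u n i - u n j) ^ 2 := by
      rw [sq_le_sq, abs_sub_comm, abs_sub_comm (u n i)]
      exact h2
    refine h5.trans (le_of_eq ?_)
    field_simp
  set C₂ : ℝ≥0 := (S : ℝ≥0) ^ d * (C₁ * (N * C)) + (S : ℝ≥0) ^ d * C with hC₂
  have hesum : ∀ n, ∑' l, e n l ≤ C₂ := by
    intro n
    simp only [he]
    rw [ENNReal.tsum_mul_left, ENNReal.tsum_mul_left, hC₂]
    push_cast
    refine le_trans ?_ le_self_add
    gcongr
    refine (hN (Y n) a (ε n) (u n)).trans ?_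
    gcongr
    exact le_add_self.trans (hC n)
  have hfsum : ∀ n, ∑' l : innerIndices S Ω (ε n),
      ENNReal.ofReal ((ε n * S) ^ d * f n l ^ 2) ≤ C₂ := by
    intro n
    rw [hC₂]
    push_cast
    refine le_trans ?_ le_add_self
    refine le_trans ?_ (mul_le_mul_right (le_self_add.trans (hC n)) _)
    unfold discreteNormSq
    rw [← ENNReal.tsum_mul_left]
    refine ENNReal.tsum_le_tsum fun l => ?_
    obtain ⟨i, hi, h1⟩ := exists_abs_average_sub_le (hX.cellNodes_nonempty hT hS hTS l) (u n) 0
    rw [sub_zero, sub_zero] at h1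
    refine le_trans ?_ (mul_le_mul_right (Finset.single_le_sum (fun _ _ => zero_le) hi) _)
    rw [← ENNReal.ofReal_natCast, ← ENNReal.ofReal_pow (by positivity),
      ← ENNReal.ofReal_mul (by positivity)]
    refine ENNReal.ofReal_le_ofReal ?_
    rw [mul_pow, mul_comm (ε n ^ d), mul_assoc, ← sq_abs (f n l)]
    have := hε n
    have h1' : |f n l| ≤ |u n i| := h1
    gcongr
  obtain ⟨φ, hφ, w, hwm, hw, hlim⟩ := exists_tendsto_of_cellControl hd hΩ hL hS hε hε0 hctrl
    hesum hfsum
  have hεφ : Tendsto (fun n => ε (φ n)) atTop (𝓝 0) := hε0.comp hφ.tendsto_atTop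
  have hperf : ∀ B : Set (Space d), Bornology.IsBounded B → Tendsto
      (fun n => perforatedError X (thinDomain k S Ω (ε (φ n)) ∩ Prod.fst ⁻¹' B) (ε (φ n))
        (u (φ n)) w) atTop (𝓝 0) := by
    intro B hB
    -- on the perforated set, the interpolation is compared with the average over the inner cell
    set G : ℕ → Space d → ℝ≥0∞ := fun n x =>
      2 * (ENNReal.ofReal (ε n ^ 2 / ε n ^ d) * e n (cubeIndex (ε n * S) x)) +
        2 * ‖f n (cubeIndex (ε n * S) x) - w x‖ₑ ^ 2 with hG
    have hm₁ : ∀ n, Measurable fun x => e n (cubeIndex (ε n * S) x) := fun n =>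
      (measurable_of_countable (e n)).comp (measurable_cubeIndex _)
    have hm₂ : ∀ n, Measurable fun x => ‖f n (cubeIndex (ε n * S) x) - w x‖ₑ ^ 2 := fun n =>
      (((measurable_of_countable (f n)).comp (measurable_cubeIndex _)).sub hwm).enorm.pow_const 2
    have hGm : ∀ n, Measurable (G n) := fun n =>
      (((hm₁ n).const_mul _).const_mul 2).add ((hm₂ n).const_mul 2)
    have hupper : ∀ n, perforatedError X (thinDomain k S Ω (ε n) ∩ Prod.fst ⁻¹' B) (ε n) (u n) w ≤
        (2 * (ENNReal.ofReal (ε n ^ 2 * S ^ d) * C₂) + 2 * ∫⁻ x in innerSet S Ω (ε n) ∩ B,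
          ‖f n (cubeIndex (ε n * S) x) - w x‖ₑ ^ 2) *
            volume (cube (S : ℝ) (0 : Fin k → ℤ)) := by
      intro n
      have hDsub : thinDomain k S Ω (ε n) ∩ Prod.fst ⁻¹' B ⊆
          (innerSet S Ω (ε n) ∩ B) ×ˢ cube (S : ℝ) (0 : Fin k → ℤ) := by
        rintro x ⟨hx, hxB⟩
        simp only [thinDomain, mem_iUnion] at hx
        obtain ⟨l, hl, hx⟩ := hx
        have hxl := (mem_cube_iff (hs _) _ _).1 hx.1
        refine ⟨⟨?_, hxB⟩, hx.2⟩
        change _ ∈ innerIndices S Ω (ε n)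
        rw [hxl]; exact hl
      have hpt : ∀ x ∈ thinDomain k S Ω (ε n) ∩ Prod.fst ⁻¹' B,
          (perforatedSet X (ε n)).indicator
            (fun x => ENNReal.ofReal (|interpolation (ε n) (u n) x - w x.1| ^ 2)) x ≤
            G n x.1 := by
        intro x hx
        refine indicator_apply_le' (fun hxX => ?_) fun _ => zero_le
        simp only [perforatedSet, mem_iUnion] at hxX
        obtain ⟨i, hiX, hi⟩ := hxX
        have h1 : interpolation (ε n) (u n) x = u n i := by
          rw [interpolation, (mem_cube_iff (hε n) _ _).1 hi.1, (mem_cube_iff one_pos _ _).1 hi.2]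
        have hinner : cubeIndex (ε n * S) x.1 ∈ innerIndices S Ω (ε n) := (hDsub hx).1.1
        have hcell : i ∈ cellNodes S X (cubeIndex (ε n * S) x.1) := by
          refine mem_cellNodes.2 ⟨fun m => ?_, fun m => ?_, hiX⟩
          · have h2 := mul_cubeIndex_le (hs n) x.1 m
            have h3 := lt_mul_cubeIndex (hs n) x.1 m
            obtain ⟨h4, h5⟩ := hi.1 m
            have h6 : (S : ℝ) * cubeIndex (ε n * S) x.1 m < i.1 m + 1 := by
              refine lt_of_mul_lt_mul_left (a := ε n) ?_ (hε n).le
              linarith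
            have h7 : (i.1 m : ℝ) < S * (cubeIndex (ε n * S) x.1 m + 1) := by
              refine lt_of_mul_lt_mul_left (a := ε n) ?_ (hε n).le
              linarith
            exact ⟨Int.lt_add_one_iff.1 (by exact_mod_cast h6), by exact_mod_cast h7⟩
          · refine ⟨(hX.bounded i hiX m).1, (hX.bounded i hiX m).2.trans_le ?_⟩
            exact_mod_cast hTS'
        rw [h1, sq_abs, ← enorm_sq_eq_ofReal]
        refine (enorm_sub_sq_le _ (f n (cubeIndex (ε n * S) x.1)) _).trans ?_
        simp only [hG]
        gcongr
        exact hosc n _ hinner i hcell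
      calc perforatedError X (thinDomain k S Ω (ε n) ∩ Prod.fst ⁻¹' B) (ε n) (u n) w
          ≤ ∫⁻ x in thinDomain k S Ω (ε n) ∩ Prod.fst ⁻¹' B, G n x.1 :=
            setLIntegral_mono ((hGm n).comp measurable_fst) hpt
        _ ≤ ∫⁻ x in (innerSet S Ω (ε n) ∩ B) ×ˢ cube (S : ℝ) (0 : Fin k → ℤ), G n x.1 :=
            lintegral_mono_set hDsub
        _ = (∫⁻ x in innerSet S Ω (ε n) ∩ B, G n x) * volume (cube (S : ℝ) (0 : Fin k → ℤ)) := by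
            have hGm' : Measurable fun x : Space d × Space k => G n x.1 :=
              (hGm n).comp measurable_fst
            rw [Measure.volume_eq_prod, ← Measure.prod_restrict,
              lintegral_prod _ hGm'.aemeasurable]
            simp only [lintegral_const, Measure.restrict_apply_univ]
            rw [lintegral_mul_const _ (hGm n)]
        _ ≤ _ := by
            gcongr
            simp only [hG]
            rw [lintegral_add_left (((hm₁ n).const_mul _).const_mul 2),
              lintegral_const_mul _ ((hm₁ n).const_mul _), lintegral_const_mul _ (hm₁ n),
              lintegral_const_mul _ (hm₂ n)]
            refine add_le_add_left (mul_le_mul_right ?_ 2) _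
            refine (mul_le_mul_right (setLIntegral_le_lintegral _ _) _).trans ?_
            rw [lintegral_comp_cubeIndex (hs n) (e n), ← mul_assoc,
              ← ENNReal.ofReal_mul (by have := hε n; positivity)]
            refine mul_le_mul' (ENNReal.ofReal_le_ofReal (le_of_eq ?_)) (hesum n)
            have := (hε n).ne'
            rw [mul_pow]
            field_simp
    have hvol : volume (cube (S : ℝ) (0 : Fin k → ℤ)) ≠ ⊤ := by
      rw [volume_cube (by linarith)]; exact ENNReal.ofReal_ne_top
    have hz : Tendsto (fun n => ENNReal.ofReal (ε (φ n) ^ 2 * S ^ d)) atTop (𝓝 0) := by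
      have h1 := ENNReal.tendsto_ofReal ((hεφ.pow 2).mul_const ((S : ℝ) ^ d))
      simpa using h1
    have hz2 := ENNReal.Tendsto.const_mul (a := 2)
      (ENNReal.Tendsto.mul_const hz (Or.inr (ENNReal.coe_ne_top (r := C₂))))
      (Or.inr ENNReal.ofNat_ne_top)
    have hz3 := ENNReal.Tendsto.const_mul (a := 2) (hlim B hB) (Or.inr ENNReal.ofNat_ne_top)
    have hz4 := ENNReal.Tendsto.mul_const (hz2.add hz3) (Or.inr hvol)
    simp only [zero_mul, mul_zero, add_zero] at hz4
    exact tendsto_of_tendsto_of_tendsto_of_le_of_le tendsto_const_nhds hz4 (fun n => zero_le)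
      fun n => hupper (φ n)
  refine ⟨φ, hφ, w, hw, fun K hK hKΩ => ?_, fun hbdd => ?_, hperf⟩
  · refine tendsto_eLpNorm_two_zero ((hlim K hK.isBounded).congr' ?_)
    obtain ⟨η, hη, hin⟩ := exists_innerSet_of_isCompact hΩ hS hK hKΩ
    filter_upwards [hεφ.eventually_lt_const hη] with n hn
    have hin' : ∀ x ∈ K, x ∈ innerSet S Ω (ε (φ n)) := fun x hx => by
      simpa using hin _ (hε _) hn x hx 0 (by simpa using (hs (φ n)).le)
    rw [inter_eq_self_of_subset_right hin']
    refine setLIntegral_congr_fun hK.measurableSet fun x hx => ?_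
    have hsub : cube (ε (φ n) * S) (cubeIndex (ε (φ n) * S) x) ⊆ Ω := fun y hy =>
      innerSet_subset hd (hε _) hS (hin' x hx) ((mem_cube_iff (hs _) _ _).1 hy)
    simp only [coarse, Function.comp_apply, if_pos hsub, hf]
  · have hsub : ∀ n, thinDomain k S Ω (ε (φ n)) ∩ Prod.fst ⁻¹' Ω = thinDomain k S Ω (ε (φ n)) := by
      intro n
      refine inter_eq_self_of_subset_left fun x hx => ?_
      simp only [thinDomain, mem_iUnion] at hx
      obtain ⟨l, hl, hx⟩ := hx
      have hxl := (mem_cube_iff (hs _) _ _).1 hx.1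
      exact innerSet_subset hd (hε _) hS (x := x.1) (show _ ∈ innerIndices S Ω (ε (φ n)) by
        rw [hxl]; exact hl) rfl
    refine (hperf Ω hbdd).congr fun n => ?_
    rw [hsub]
    rfl

end Cells

/-! ### The two compactness statements -/

theorem mainTheorem5 {d k : ℕ} (hd : 1 ≤ d) (hk : 1 ≤ k) (T : ℕ) (hT : 1 ≤ T)
    (X : Set (Node d k)) (E : Set (Node d k × Node d k)) (a : Node d k → Node d k → ℝ)
    (hX : IsThinNetwork T X E a) :
    -- functions on the whole of `ε X`, with the energy of all the interactions
    (∀ Ω : Set (Space d), IsOpen Ω → HasLipschitzBoundary Ω →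
      ∀ ε : ℕ → ℝ, (∀ n, 0 < ε n) → Tendsto ε atTop (𝓝 0) →
      ∀ (u : ℕ → Node d k → ℝ) (C : ℝ≥0),
        (∀ n, discreteNormSq T X Ω (ε n) (u n) + energy X a (ε n) (u n) ≤ C) →
        ∃ φ : ℕ → ℕ, StrictMono φ ∧ ∃ w : Space d → ℝ, MemH1 Ω w ∧
          PerforatedConvergence T X Ω (ε ∘ φ) (u ∘ φ) w) ∧
    -- localized energy, only with the interactions over `Ω`, up to taking a larger period
    (∃ T₀ : ℕ, ∀ T' : ℕ, 1 ≤ T' → T ∣ T' → T₀ ≤ T' →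
      ∀ Ω : Set (Space d), IsOpen Ω → HasLipschitzBoundary Ω →
      ∀ ε : ℕ → ℝ, (∀ n, 0 < ε n) → Tendsto ε atTop (𝓝 0) →
      ∀ (u : ℕ → Node d k → ℝ) (C : ℝ≥0),
        (∀ n, discreteNormSq T' X Ω (ε n) (u n) +
          energy (nodesOver X Ω (ε n)) a (ε n) (u n) ≤ C) →
        ∃ φ : ℕ → ℕ, StrictMono φ ∧ ∃ w : Space d → ℝ, MemH1 Ω w ∧
          PerforatedConvergence T' X Ω (ε ∘ φ) (u ∘ φ) w) := by
  obtain ⟨ρ, hρ⟩ := hX.exists_pairEnergy_le hT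
  refine ⟨fun Ω hΩ hL ε hε hε0 u C hC => ?_,
    4 * ρ, fun T' hT' hTT' hT₀ Ω hΩ hL ε hε hε0 u C hC => ?_⟩
  · exact hX.exists_perforatedConvergence hd hT hρ hT dvd_rfl hΩ hL hε hε0
      (fun n y _ q hq _ => hq) hC
  · refine hX.exists_perforatedConvergence hd hT hρ hT' hTT' hΩ hL hε hε0
      (Y := fun n => nodesOver X Ω (ε n)) (fun n y hy q hq hqy => ⟨hq, hy ?_⟩) hC
    -- since `4 ρ ≤ T'`, such a node lies within `3/2 ε T'` of `y` in the sup norm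
    have hpos : 0 < ε n * T' := mul_pos (hε n) (by exact_mod_cast hT')
    have hρT : ε n * ρ ≤ 1 / 4 * (ε n * T') := by
      have : (4 * ρ : ℝ) ≤ T' := by exact_mod_cast hT₀
      nlinarith [hε n]
    have hd0 : 0 < Real.sqrt d := Real.sqrt_pos.2 (by exact_mod_cast hd)
    rw [Metric.mem_ball, dist_eq_norm]
    refine (norm_le_sqrt_mul (c := 3 / 2 * (ε n * T')) (by positivity) fun m => ?_).trans_lt ?_
    · exact (hqy m).trans (by linarith)
    · nlinarith [mul_pos hd0 hpos]
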